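/- Let $\alpha>0$. For even $n_1\ge 0$ let $n_2=\lfloor \alpha n_1/2\rfloor$, and let $\mathcal G_{n_1,n_2}$ be the set of simple graphs with vertex set $\{1,\dots,n_1+n_2\}$ having exactly $n_1$ vertices of degree $1$ and exactly $n_2$ vertices of degree $2$. For $j\ge 2$ let $U_j$ be the number of connected components with exactly $j$ vertices in a uniformly random element of $\mathcal G_{n_1,n_2}$. Then, for every fixed $j\ge 2$, as $n_1\to\infty$ along the even integers, \[ \mathbb{E}[U_j]\sim \frac{\alpha^{j-2}}{(1+\alpha)^{j-1}}\,\frac{n_1}{2} \qquad\text{and}\qquad \operatorname{Var}(U_j)=O(n_1). \] Furthermore, for every integer $q\ge 2$, the matrix $\mathcal H(\alpha)=(\mathcal H_{i,j}(\alpha))_{2\le i,j\le q}$ given by \[ \mathcal H_{i,j}(\alpha)= -\frac{\alpha^{i+j-4}}{(1+\alpha)^{i+j-2}}\left(1+\frac{(i-2-\alpha)(j-2-\alpha)}{\alpha(1+\alpha)}\right)+\frac{\mathbb 1_{i=j}}{1+\alpha}\left(\frac{\alpha}{1+\alpha}\right)^{i-2} \] is positive semi-definite, and, as $n_1\to\infty$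 along the even integers, the vector \[ \frac{1}{\sqrt{n_1/2}}\left(U_j-\frac{\alpha^{j-2}}{(1+\alpha)^{j-1}}\,\frac{n_1}{2}\right)_{2\le j\le q} \] converges in distribution to the centred multivariate Gaussian $\mathcal N(0,\mathcal H(\alpha))$ with covariance matrix $\mathcal H(\alpha)$. -/

import Mathlib

open MeasureTheory ProbabilityTheory Filter Asymptotics

namespace DegOneTwo

open Classical in
/-- The labelled simple graphs on `n₁ + n₂` vertices with exactly `n₁` vertices of degree `1`
and exactly `n₂` vertices of degree `2` (so that every vertex has degree `1` or `2`). -/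
def graphs (n₁ n₂ : ℕ) : Set (SimpleGraph (Fin (n₁ + n₂))) :=
  {G | (Finset.univ.filter fun v => G.degree v = 1).card = n₁ ∧
       (Finset.univ.filter fun v => G.degree v = 2).card = n₂}

/-- The law of a uniformly random element of `graphs n₁ n₂`. -/
noncomputable def uniformGraph (n₁ n₂ : ℕ) : Measure (SimpleGraph (Fin (n₁ + n₂))) :=
  uniformOn (graphs n₁ n₂)

/-- The number `U_j` of connected components of `G` with exactly `j` vertices. -/
noncomputable def numComponents {V : Type*} (j : ℕ) (G : SimpleGraph V) : ℕ :=
  {C : G.ConnectedComponent | C.supp.ncard = j}.ncard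

/-- The coefficient `α ^ (j - 2) / (1 + α) ^ (j - 1)`, used for `j ≥ 2`. -/
noncomputable def density (α : ℝ) (j : ℕ) : ℝ := α ^ (j - 2) / (1 + α) ^ (j - 1)

/-- The matrix `H(α)`, with rows and columns indexed by `2, …, q`. -/
noncomputable def limitCov (α : ℝ) (q : ℕ) : Matrix (Finset.Icc 2 q) (Finset.Icc 2 q) ℝ :=
  Matrix.of fun i j =>
    -(α ^ ((i : ℕ) + (j : ℕ) - 4) / (1 + α) ^ ((i : ℕ) + (j : ℕ) - 2)) *
        (1 + (((i : ℕ) : ℝ) - 2 - α) * (((j : ℕ) : ℝ) - 2 - α) / (α * (1 + α)))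
      + (if i = j then 1 else 0) / (1 + α) * (α / (1 + α)) ^ ((i : ℕ) - 2)

/-- The centred and rescaled vector of component counts
`(U_j - α ^ (j - 2) / (1 + α) ^ (j - 1) * k) / √k`, for `2 ≤ j ≤ q`. -/
noncomputable def rescaledCounts {V : Type*} (α : ℝ) (q k : ℕ) (G : SimpleGraph V) :
    EuclideanSpace ℝ (Finset.Icc 2 q) :=
  WithLp.toLp 2 fun j => (1 / √(k : ℝ)) * ((numComponents (j : ℕ) G : ℝ) - density α j * k)

instance measurableSingletonClass_simpleGraph (n : ℕ) :
    MeasurableSingletonClass (SimpleGraph (Fin n)) where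
  measurableSet_singleton G := by
    have h : ({G} : Set (SimpleGraph (Fin n))) = SimpleGraph.edgeSet ⁻¹' {G.edgeSet} := by
      ext H; simp
    rw [h]
    exact SimpleGraph.measurable_edgeSet (measurableSet_singleton _)

/-- A path on `m + 2` vertices together with `k` disjoint edges. -/
theorem graphs_nonempty (k m : ℕ) : (graphs (2 * (k + 1)) m).Nonempty := by
  classical
  let R : ℕ → ℕ → Prop := fun a b => b = a + 1 ∧ (a ≤ m ∨ Even (a + m))
  let G : SimpleGraph (Fin (2 * (k + 1) + m)) :=
    { Adj := fun a b => R a b ∨ R b a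
      symm := ⟨fun a b h => h.symm⟩
      loopless := ⟨fun a h => by simp [R] at h⟩ }
  have hdeg2 : ∀ v : Fin (2 * (k + 1) + m), (1 ≤ (v : ℕ) ∧ (v : ℕ) ≤ m) → G.degree v = 2 := by
    rintro ⟨v, hv⟩ ⟨h1, h2⟩
    simp only at h1 h2
    rw [← SimpleGraph.card_neighborFinset_eq_degree, Finset.card_eq_two]
    refine ⟨⟨v - 1, by omega⟩, ⟨v + 1, by omega⟩, by simp, ?_⟩
    ext ⟨w, hw⟩
    simp only [SimpleGraph.mem_neighborFinset, Finset.mem_insert, Finset.mem_singleton,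
      Fin.mk.injEq, G, R]
    grind
  have hdeg1 : ∀ v : Fin (2 * (k + 1) + m), ¬ (1 ≤ (v : ℕ) ∧ (v : ℕ) ≤ m) → G.degree v = 1 := by
    rintro ⟨v, hv⟩ h
    simp only at h
    rw [← SimpleGraph.card_neighborFinset_eq_degree, Finset.card_eq_one]
    by_cases h0 : v = 0 ∨ Even (v + m)
    · refine ⟨⟨v + 1, by grind⟩, ?_⟩
      ext ⟨w, hw⟩
      simp only [SimpleGraph.mem_neighborFinset, Finset.mem_singleton, Fin.mk.injEq, G, R]
      grind
    · refine ⟨⟨v - 1, by omega⟩, ?_⟩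
      ext ⟨w, hw⟩
      simp only [SimpleGraph.mem_neighborFinset, Finset.mem_singleton, Fin.mk.injEq, G, R]
      grind
  have h2 : (Finset.univ.filter fun v => G.degree v = 2).card = m := by
    have : (Finset.univ.filter fun v => G.degree v = 2)
        = (Finset.Icc ⟨1, by omega⟩ ⟨m, by omega⟩ : Finset (Fin (2 * (k + 1) + m))) := by
      ext v
      simp only [Finset.mem_filter, Finset.mem_univ, true_and, Finset.mem_Icc, Fin.le_def]
      by_cases h : 1 ≤ (v : ℕ) ∧ (v : ℕ) ≤ m
      · simp [hdeg2 v h, h]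
      · simp [hdeg1 v h, h]
    rw [this, Fin.card_Icc]
    simp
  have h1 : (Finset.univ.filter fun v => G.degree v = 1).card = 2 * (k + 1) := by
    have e : (Finset.univ.filter fun v => G.degree v = 1)
        = Finset.univ.filter fun v => ¬ G.degree v = 2 := by
      ext v
      simp only [Finset.mem_filter, Finset.mem_univ, true_and]
      by_cases h : 1 ≤ (v : ℕ) ∧ (v : ℕ) ≤ m
      · simp [hdeg2 v h]
      · simp [hdeg1 v h]
    have := Finset.card_filter_add_card_filter_not (s := Finset.univ)
      (fun v : Fin (2 * (k + 1) + m) => G.degree v = 2)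
    rw [e]
    simp only [Finset.card_univ, Fintype.card_fin] at this
    omega
  refine ⟨G, ?_, ?_⟩
  · convert h1
  · convert h2

instance isProbabilityMeasure_uniformGraph (α : ℝ) (k : ℕ) :
    IsProbabilityMeasure (uniformGraph (2 * k) ⌊α * (k : ℝ)⌋₊) := by
  refine isProbabilityMeasure_uniformOn (Set.toFinite _) ?_
  cases k with
  | zero =>
    have h : ⌊α * ((0 : ℕ) : ℝ)⌋₊ = 0 := by simp
    rw [h]
    exact ⟨⊥, by simp [graphs]⟩
  | succ k => exact graphs_nonempty k _

end DegOneTwo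

/-!
The proof reduces the random graph to a uniform composition, and compares the composition with
independent geometric variables.

*Structure.* A graph with all degrees `1` or `2` consists of paths and cycles. Peeling off the path
that starts at a leaf, vertex by vertex (`markSum_succ_succ`, `markSum_succ_one`, `memSum_peel`),
shows that the sizes of the `k` paths, in order, form a uniform weak composition of `m - l` into `k`
parts once the number `l` of vertices on cycles is given, and that the cycles are an arbitrary
`2`-regular graph (`memSum_eq_sum_compositions`). There are at most `l!` such `2`-regular graphs
(`memSum_zero_le_factorial`), whereas the number of compositions decays geometrically in `l`
(`numComp_sub_le`), so `l` has bounded moments, and every mean over graphs is close to the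
corresponding mean over compositions of `m` (`norm_integral_uniformGraph_sub_le`).

*Mean and variance.* The probability that a part of a uniform composition equals `r` is a product of
`r + 1` factors, each a Lipschitz function of the parameters (`numComp_sub_eq`,
`abs_partProb_sub_le`). This gives the means, and bounds the correlation of two parts by the inverse
of their number, whence a variance of linear order (`compMean_sq_le`).

*Central limit theorem.* Let `ϑ` be a finitely supported function of the part size, and let the
residual `ξ` be `ϑ` minus its linear regression on the part size under the geometric law of mean
`α`. By the Pólya urn identity (`compMean_succ`), a uniform composition of `M + 1` arises from one
of `M` by increasing a part `i` with probability proportional to `a i + 1`. The regression slope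
cancels the drift of `∑ i, ϑ (a i)` under this step, so that the characteristic function of
`∑ i, ξ (a i) / √k` is insensitive to a change of `M` of order `√k`
(`exists_norm_compCharFun_sub_le`). Averaging over a negative binomial `M` turns the composition
into independent geometric variables, for which the classical theorem holds
(`tendsto_geometric_charFun_pow`); hence it holds for `M = m` (`tendsto_compCharFun`). The limit
variance is the variance of the residual, which is the quadratic form of `limitCov`
(`dotProduct_limitCov`); in particular that matrix is positive semi-definite. Lévy's continuity
theorem finishes the proof.
-/

namespace DegOneTwo

open Finset.Nat (antidiagonalTuple)
open scoped Topology

/-! ### Degrees, components and the removal of a vertex -/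

open scoped Classical in
/-- The degree of a vertex, as a sum of adjacency indicators. -/
noncomputable def vdeg {N : ℕ} (G : SimpleGraph (Fin N)) (u : Fin N) : ℕ :=
  ∑ w, if G.Adj u w then 1 else 0

open scoped Classical in
/-- The number of vertices in the component of `u`. -/
noncomputable def compSize {N : ℕ} (G : SimpleGraph (Fin N)) (u : Fin N) : ℕ :=
  (Finset.univ.filter fun w => G.Reachable u w).card

open scoped Classical in
/-- The component counts, obtained by counting vertices: the components of size `j` hold `j`
vertices each. -/
noncomputable def compCount {N : ℕ} (G : SimpleGraph (Fin N)) (j : ℕ) : ℕ :=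
  (Finset.univ.filter fun u => compSize G u = j).card / j

open scoped Classical in
/-- The component counts of `G` with the component of `v` left out. -/
noncomputable def restCount {N : ℕ} (G : SimpleGraph (Fin N)) (v : Fin N) (j : ℕ) : ℕ :=
  (Finset.univ.filter fun u => ¬ G.Reachable v u ∧ compSize G u = j).card / j

/-- Every degree is `1` or `2`, and exactly `D` of them are `1`. -/
def IsMem {N : ℕ} (D : ℕ) (G : SimpleGraph (Fin N)) : Prop :=
  (∀ u, 1 ≤ vdeg G u ∧ vdeg G u ≤ 2) ∧ ∑ u, (2 - vdeg G u) = D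

/-- The marked graphs met while a path is peeled off from one of its ends: the mark `v` is a leaf or
an isolated vertex, and all other degrees are `1` or `2`. The total defect `D` counts an isolated
mark twice, which makes it invariant under the removal of a marked leaf. -/
def IsMarked {N : ℕ} (D : ℕ) (G : SimpleGraph (Fin N)) (v : Fin N) : Prop :=
  vdeg G v ≤ 1 ∧ (∀ u, u ≠ v → 1 ≤ vdeg G u ∧ vdeg G u ≤ 2) ∧ ∑ u, (2 - vdeg G u) = D

/-- The graph obtained from `G` by adding a vertex `v` with neighbourhood `P`. -/
def extend {N : ℕ} (v : Fin (N + 1)) (P : Finset (Fin N)) (G : SimpleGraph (Fin N)) :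
    SimpleGraph (Fin (N + 1)) where
  Adj a b := (∃ x y, v.succAbove x = a ∧ v.succAbove y = b ∧ G.Adj x y) ∨
    (a = v ∧ ∃ y ∈ P, v.succAbove y = b) ∨ (b = v ∧ ∃ y ∈ P, v.succAbove y = a)
  symm := ⟨by
    rintro a b (⟨x, y, h1, h2, h⟩ | h | h)
    · exact Or.inl ⟨y, x, h2, h1, h.symm⟩
    · exact Or.inr (Or.inr h)
    · exact Or.inr (Or.inl h)⟩
  loopless := ⟨by
    rintro a (⟨x, y, h1, h2, h⟩ | ⟨rfl, y, -, h⟩ | ⟨rfl, y, -, h⟩)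
    · rw [← h2] at h1
      rw [Fin.succAbove_right_injective h1] at h
      exact G.irrefl h
    · exact Fin.succAbove_ne _ _ h
    · exact Fin.succAbove_ne _ _ h⟩

lemma self_or_succAbove {N : ℕ} (v a : Fin (N + 1)) : v = a ∨ ∃ x, v.succAbove x = a := by
  obtain h | ⟨x, h⟩ := Fin.eq_self_or_eq_succAbove v a
  · exact Or.inl h.symm
  · exact Or.inr ⟨x, h.symm⟩

section extend
variable {N : ℕ} (v : Fin (N + 1)) (P : Finset (Fin N)) (G : SimpleGraph (Fin N))

@[simp] lemma extend_adj_succAbove (x y : Fin N) :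
    (extend v P G).Adj (v.succAbove x) (v.succAbove y) ↔ G.Adj x y := by
  simp [extend]

@[simp] lemma extend_adj_self_succAbove (y : Fin N) :
    (extend v P G).Adj v (v.succAbove y) ↔ y ∈ P := by
  simp [extend]

@[simp] lemma extend_adj_succAbove_self (y : Fin N) :
    (extend v P G).Adj (v.succAbove y) v ↔ y ∈ P := by
  rw [SimpleGraph.adj_comm, extend_adj_self_succAbove]

open scoped Classical in
/-- A graph on `N + 1` vertices is a graph on the vertices other than `v` together with the
neighbourhood of `v`. -/
noncomputable def extendEquiv :
    SimpleGraph (Fin N) × Finset (Fin N) ≃ SimpleGraph (Fin (N + 1)) where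
  toFun p := extend v p.2 p.1
  invFun H := (H.comap v.succAbove, Finset.univ.filter fun y => H.Adj v (v.succAbove y))
  left_inv := by
    rintro ⟨G, P⟩
    ext <;> simp
  right_inv := by
    intro H
    ext a b
    obtain rfl | ⟨x, rfl⟩ := self_or_succAbove v a <;>
    obtain rfl | ⟨y, rfl⟩ := self_or_succAbove v b <;>
    simp [SimpleGraph.adj_comm]

lemma sum_extend {E : Type*} [AddCommMonoid E] (f : SimpleGraph (Fin (N + 1)) → E) :
    ∑ H, f H = ∑ G, ∑ P, f (extend v P G) := by
  rw [← Fintype.sum_prod_type', ← (extendEquiv v).sum_comp]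
  rfl

lemma vdeg_extend_self : vdeg (extend v P G) v = P.card := by
  classical
  simp [vdeg, Fin.sum_univ_succAbove _ v]

open scoped Classical in
lemma vdeg_extend_succAbove (x : Fin N) :
    vdeg (extend v P G) (v.succAbove x) = (if x ∈ P then 1 else 0) + vdeg G x := by
  simp [vdeg, Fin.sum_univ_succAbove _ v]

end extend

lemma reachable_of_map {V W : Type*} {G : SimpleGraph V} {H : SimpleGraph W} (f : V → W)
    (h : ∀ a b, G.Adj a b → H.Reachable (f a) (f b)) {a b : V} (hab : G.Reachable a b) :
    H.Reachable (f a) (f b) := by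
  obtain ⟨p⟩ := hab
  induction p with
  | nil => rfl
  | cons hadj _ ih => exact (h _ _ hadj).trans ih

section leaf
variable {N : ℕ} (v : Fin (N + 1)) (w : Fin N) (G : SimpleGraph (Fin N))

lemma extend_reachable_succAbove_of (P : Finset (Fin N)) {x y : Fin N} (h : G.Reachable x y) :
    (extend v P G).Reachable (v.succAbove x) (v.succAbove y) :=
  reachable_of_map _ (fun a b hab => SimpleGraph.Adj.reachable (by simpa using hab)) h

lemma leaf_reachable_retract {a b : Fin (N + 1)} (h : (extend v {w} G).Reachable a b) :
    G.Reachable (Fin.insertNth (α := fun _ => Fin N) v w id a)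
      (Fin.insertNth (α := fun _ => Fin N) v w id b) := by
  refine reachable_of_map _ (fun a b hab => ?_) h
  obtain rfl | ⟨x, rfl⟩ := self_or_succAbove v a <;>
  obtain rfl | ⟨y, rfl⟩ := self_or_succAbove v b
  · simp
  · simp only [extend_adj_self_succAbove, Finset.mem_singleton] at hab
    simp [hab]
  · simp only [extend_adj_succAbove_self, Finset.mem_singleton] at hab
    simp [hab]
  · simp only [extend_adj_succAbove] at hab
    simpa using hab.reachable

@[simp] lemma leaf_reachable_succAbove {x y : Fin N} :
    (extend v {w} G).Reachable (v.succAbove x) (v.succAbove y) ↔ G.Reachable x y :=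
  ⟨fun h => by simpa using leaf_reachable_retract v w G h,
    fun h => extend_reachable_succAbove_of v G _ h⟩

@[simp] lemma leaf_reachable_self {y : Fin N} :
    (extend v {w} G).Reachable v (v.succAbove y) ↔ G.Reachable w y :=
  ⟨fun h => by simpa using leaf_reachable_retract v w G h,
    fun h => (SimpleGraph.Adj.reachable (by simp)).trans (extend_reachable_succAbove_of v G _ h)⟩

@[simp] lemma leaf_reachable_self' {y : Fin N} :
    (extend v {w} G).Reachable (v.succAbove y) v ↔ G.Reachable w y := by
  rw [SimpleGraph.reachable_comm, leaf_reachable_self]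

lemma isolated_reachable_iff {a b : Fin (N + 1)} (h : (extend v ∅ G).Reachable a b) :
    a = b ∨ ∃ x y, v.succAbove x = a ∧ v.succAbove y = b ∧ G.Reachable x y := by
  obtain ⟨p⟩ := h
  induction p with
  | nil => simp
  | @cons a b c hadj _ ih =>
    right
    obtain rfl | ⟨x, rfl⟩ := self_or_succAbove v a <;>
    obtain rfl | ⟨y, rfl⟩ := self_or_succAbove v b <;> simp at hadj
    rcases ih with rfl | ⟨x', y', h1, h2, h3⟩
    · exact ⟨x, y, rfl, rfl, hadj.reachable⟩
    · refine ⟨x, y', rfl, h2, ?_⟩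
      rw [← Fin.succAbove_right_injective h1] at hadj
      exact hadj.reachable.trans h3

@[simp] lemma isolated_reachable_succAbove {x y : Fin N} :
    (extend v ∅ G).Reachable (v.succAbove x) (v.succAbove y) ↔ G.Reachable x y := by
  refine ⟨fun h => ?_, fun h => extend_reachable_succAbove_of v G _ h⟩
  rcases isolated_reachable_iff v G h with h | ⟨x', y', h1, h2, h3⟩
  · rw [Fin.succAbove_right_injective h]
  · rwa [← Fin.succAbove_right_injective h1, ← Fin.succAbove_right_injective h2]

@[simp] lemma isolated_reachable_self {y : Fin N} :
    ¬ (extend v ∅ G).Reachable v (v.succAbove y) := by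
  intro h
  rcases isolated_reachable_iff v G h with h | ⟨x', y', h1, h2, h3⟩
  · exact Fin.succAbove_ne _ _ h.symm
  · exact Fin.succAbove_ne _ _ h1

@[simp] lemma isolated_reachable_self' {y : Fin N} :
    ¬ (extend v ∅ G).Reachable (v.succAbove y) v := by
  rw [SimpleGraph.reachable_comm]; simp

lemma card_filter_succAbove (p : Fin (N + 1) → Prop) [DecidablePred p] :
    (Finset.univ.filter p).card
      = (if p v then 1 else 0) + (Finset.univ.filter fun x => p (v.succAbove x)).card := by
  simp only [Finset.card_filter, Fin.sum_univ_succAbove _ v]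

lemma compSize_leaf_self : compSize (extend v {w} G) v = compSize G w + 1 := by
  classical
  simp [compSize, card_filter_succAbove v, add_comm]

lemma compSize_leaf_succAbove {x : Fin N} (hx : ¬ G.Reachable w x) :
    compSize (extend v {w} G) (v.succAbove x) = compSize G x := by
  classical
  simp [compSize, card_filter_succAbove v, hx]

lemma restCount_leaf : restCount (extend v {w} G) v = restCount G w := by
  classical
  funext j
  unfold restCount
  rw [card_filter_succAbove v]
  simp only [SimpleGraph.Reachable.refl, not_true_eq_false, false_and, ite_false, zero_add,
    leaf_reachable_self]
  congr 2
  ext x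
  simp only [Finset.mem_filter, Finset.mem_univ, true_and, and_congr_right_iff]
  intro hx
  rw [compSize_leaf_succAbove v w G hx]

lemma compSize_isolated_self : compSize (extend v ∅ G) v = 1 := by
  classical
  simp [compSize, card_filter_succAbove v]

lemma compSize_isolated_succAbove {x : Fin N} :
    compSize (extend v ∅ G) (v.succAbove x) = compSize G x := by
  classical
  simp [compSize, card_filter_succAbove v]

lemma restCount_isolated : restCount (extend v ∅ G) v = compCount G := by
  classical
  funext j
  unfold restCount compCount
  rw [card_filter_succAbove v]
  simp [compSize_isolated_succAbove]

end leaf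

section basic
variable {N : ℕ} (G : SimpleGraph (Fin N))

lemma compSize_pos (u : Fin N) : 1 ≤ compSize G u := by
  classical
  rw [compSize, Nat.one_le_iff_ne_zero, Finset.card_ne_zero]
  exact ⟨u, by simp⟩

lemma compSize_le (u : Fin N) : compSize G u ≤ N := by
  classical
  simpa [compSize] using Finset.card_le_univ (Finset.univ.filter fun w => G.Reachable u w)

lemma compSize_congr {u w : Fin N} (h : G.Reachable u w) : compSize G u = compSize G w := by
  classical
  unfold compSize
  congr 1
  ext x
  simp only [Finset.mem_filter, Finset.mem_univ, true_and]
  exact ⟨fun hx => h.symm.trans hx, fun hx => h.trans hx⟩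

/-- A component has at least two vertices exactly when its vertices are not isolated. -/
lemma two_le_compSize_iff (u : Fin N) : 2 ≤ compSize G u ↔ 1 ≤ vdeg G u := by
  classical
  constructor
  · intro h
    by_contra hd
    have hno : ∀ w, ¬ G.Adj u w := by
      simpa [vdeg, Finset.card_eq_zero, Finset.filter_eq_empty_iff] using hd
    have : Finset.univ.filter (fun w => G.Reachable u w) ⊆ {u} := by
      intro x hx
      simp only [Finset.mem_filter, Finset.mem_univ, true_and] at hx
      obtain ⟨p⟩ := hx
      cases p with
      | nil => simp
      | cons hadj _ => exact absurd hadj (hno _)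
    have := Finset.card_le_card this
    simp only [compSize] at h
    simp at this
    omega
  · intro h
    have : ∃ w, G.Adj u w := by
      by_contra hno
      push Not at hno
      simp [vdeg, hno] at h
    obtain ⟨w, hw⟩ := this
    have h2 : ({u, w} : Finset (Fin N)) ⊆ Finset.univ.filter fun w => G.Reachable u w := by
      intro x hx
      simp only [Finset.mem_insert, Finset.mem_singleton] at hx
      rcases hx with rfl | rfl
      · simp
      · simpa using hw.reachable
    have := Finset.card_le_card h2
    rwa [Finset.card_pair hw.ne] at this

lemma compCount_eq (v : Fin N) :
    compCount G = restCount G v + Pi.single (compSize G v) 1 := by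
  classical
  funext j
  unfold compCount restCount
  have hsplit : (Finset.univ.filter fun u => compSize G u = j).card
      = (Finset.univ.filter fun u => ¬ G.Reachable v u ∧ compSize G u = j).card
        + if compSize G v = j then j else 0 := by
    rw [← Finset.card_filter_add_card_filter_not (s := Finset.univ.filter fun u => compSize G u = j)
      (fun u => ¬ G.Reachable v u), Finset.filter_filter, Finset.filter_filter]
    congr 1
    · congr 1; ext; simp [and_comm]
    · split_ifs with h
      · refine Eq.trans ?_ h
        rw [compSize]
        congr 1
        ext x
        simp only [Finset.mem_filter, Finset.mem_univ, true_and, not_not]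
        exact ⟨fun hx => hx.2, fun hx => ⟨(compSize_congr G hx).symm.trans h, hx⟩⟩
      · rw [Finset.card_eq_zero, Finset.filter_eq_empty_iff]
        rintro x - ⟨hx, hx2⟩
        rw [not_not] at hx2
        exact h ((compSize_congr G hx2).trans hx)
  rw [hsplit]
  by_cases h : compSize G v = j
  · subst h
    have := compSize_pos G v
    simp [Nat.add_div_right _ this]
  · simp [h, Ne.symm h]

/-- Double counting of the vertices lying in components of size `j`. -/
lemma mul_numComponents (j : ℕ) : j * numComponents j G
    = {u : Fin N | (G.connectedComponentMk u).supp.ncard = j}.ncard := by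
  classical
  unfold numComponents
  rw [Set.ncard_eq_toFinset_card', Set.ncard_eq_toFinset_card']
  rw [Finset.card_eq_sum_card_fiberwise (f := fun u => G.connectedComponentMk u)
    (t := {C : G.ConnectedComponent | C.supp.ncard = j}.toFinset)]
  · rw [mul_comm, ← smul_eq_mul, ← Finset.sum_const]
    refine Finset.sum_congr rfl fun C hC => ?_
    simp only [Set.mem_toFinset, Set.mem_ofPred_eq] at hC
    conv_lhs => rw [← hC]
    rw [Set.ncard_eq_toFinset_card']
    congr 1
    ext x
    simp only [Set.mem_toFinset, SimpleGraph.ConnectedComponent.mem_supp_iff, Finset.mem_filter,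
      Set.mem_ofPred_eq]
    refine ⟨fun h => ⟨by rw [h, hC], h⟩, fun h => h.2⟩
  · intro x hx
    simpa using hx

lemma numComponents_eq_compCount {j : ℕ} (hj : j ≠ 0) : numComponents j G = compCount G j := by
  classical
  have h : (Finset.univ.filter fun u => compSize G u = j).card = j * numComponents j G := by
    rw [mul_numComponents, Set.ncard_eq_toFinset_card']
    congr 1
    ext u
    simp only [Finset.mem_filter, Finset.mem_univ, true_and, Set.mem_toFinset, Set.mem_ofPred_eq]
    rw [Set.ncard_eq_toFinset_card', compSize]
    have : (G.connectedComponentMk u).supp.toFinset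
        = Finset.univ.filter fun w => G.Reachable u w := by
      ext x
      simp [SimpleGraph.reachable_comm]
    rw [this]
  rw [compCount, h, Nat.mul_div_cancel_left _ (Nat.pos_of_ne_zero hj)]

lemma compCount_le (j : ℕ) : compCount G j ≤ N := by
  classical
  exact (Nat.div_le_self _ _).trans
    (by simpa using Finset.card_le_univ (Finset.univ.filter fun u => compSize G u = j))

end basic

/-! ### Peeling a path off from its end -/

open scoped Classical in
/-- The sum of `F` over the component counts of all graphs on `N` vertices with degrees `1` and `2`,
`D` of them equal to `1`. -/
noncomputable def memSum {E : Type*} [AddCommMonoid E] (N D : ℕ) (F : (ℕ → ℕ) → E) : E :=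
  ∑ G : SimpleGraph (Fin N), if IsMem D G then F (compCount G) else 0

open scoped Classical in
/-- The sum of `F` over the counts of the components away from the mark, over all marked graphs on
`N` vertices whose mark lies in a component of size `j`. -/
noncomputable def markSum {E : Type*} [AddCommMonoid E] (N D j : ℕ) (F : (ℕ → ℕ) → E) : E :=
  ∑ v : Fin N, ∑ G : SimpleGraph (Fin N),
    if IsMarked D G v ∧ compSize G v = j then F (restCount G v) else 0

section
variable {N : ℕ} (v : Fin (N + 1)) (w : Fin N) (G : SimpleGraph (Fin N)) (D : ℕ)

lemma isMarked_leaf_iff : IsMarked D (extend v {w} G) v ↔ IsMarked D G w := by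
  classical
  unfold IsMarked
  simp only [Fin.forall_iff_succAbove v, vdeg_extend_self, vdeg_extend_succAbove,
    Finset.card_singleton, le_refl, true_and, ne_eq, not_true_eq_false, false_imp_iff,
    Fin.succAbove_ne, not_false_eq_true, true_imp_iff, Finset.mem_singleton,
    Fin.sum_univ_succAbove _ v]
  have hdeg : (∀ x, 1 ≤ (if x = w then 1 else 0) + vdeg G x ∧
      (if x = w then 1 else 0) + vdeg G x ≤ 2) ↔
      (vdeg G w ≤ 1 ∧ ∀ u, u ≠ w → 1 ≤ vdeg G u ∧ vdeg G u ≤ 2) := by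
    constructor
    · intro h
      refine ⟨?_, fun u hu => by simpa [hu] using h u⟩
      have := h w
      simp at this
      omega
    · rintro ⟨h1, h2⟩ x
      by_cases hx : x = w
      · subst hx; simp; omega
      · simpa [hx] using h2 x hx
  rw [hdeg, and_assoc, and_congr_right_iff]
  intro hw
  rw [and_congr_right_iff]
  rintro -
  have hsum : ∑ u, (2 - vdeg G u)
      = (2 - 1) + ∑ x, (2 - ((if x = w then 1 else 0) + vdeg G x)) := by
    rw [← Finset.add_sum_erase _ _ (Finset.mem_univ w),
      ← Finset.add_sum_erase (a := w) (f := fun x => 2 - ((if x = w then 1 else 0) + vdeg G x)) _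
        (Finset.mem_univ w)]
    rw [Finset.sum_congr rfl (g := fun x => 2 - vdeg G x) (s₁ := Finset.univ.erase w)
      (f := fun x => 2 - ((if x = w then 1 else 0) + vdeg G x))
      (fun x hx => by simp [Finset.ne_of_mem_erase hx])]
    simp only [if_true]
    omega
  rw [hsum]

lemma isMarked_isolated_iff : IsMarked (D + 2) (extend v ∅ G) v ↔ IsMem D G := by
  classical
  unfold IsMarked IsMem
  simp only [Fin.forall_iff_succAbove v, vdeg_extend_self, vdeg_extend_succAbove,
    Finset.card_empty, zero_le, true_and, ne_eq, not_true_eq_false, false_imp_iff,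
    Fin.succAbove_ne, not_false_eq_true, true_imp_iff, Finset.notMem_empty,
    Fin.sum_univ_succAbove _ v, if_false, zero_add]
  rw [and_congr_right_iff]
  rintro -
  omega

lemma isMarked_and_two_le_iff {N : ℕ} (v : Fin N) (G : SimpleGraph (Fin N)) :
    IsMarked D G v ∧ 2 ≤ compSize G v ↔ IsMem D G ∧ vdeg G v = 1 := by
  rw [two_le_compSize_iff]
  unfold IsMarked IsMem
  constructor
  · rintro ⟨⟨h1, h2, h3⟩, h4⟩
    refine ⟨⟨fun u => ?_, h3⟩, by omega⟩
    by_cases hu : u = v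
    · subst hu; omega
    · exact h2 u hu
  · rintro ⟨⟨h1, h2⟩, h3⟩
    exact ⟨⟨h3.le, fun u _ => h1 u, h2⟩, h3.ge⟩

end

variable {E : Type*} [AddCommMonoid E]

/-- A marked leaf is removed, and the mark moves to its neighbour. -/
lemma markSum_succ_succ (N D j : ℕ) (F : (ℕ → ℕ) → E) :
    markSum (N + 1) D (j + 2) F = (N + 1) • markSum N D (j + 1) F := by
  classical
  have key : ∀ v : Fin (N + 1), (∑ H : SimpleGraph (Fin (N + 1)),
      if IsMarked D H v ∧ compSize H v = j + 2 then F (restCount H v) else 0)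
      = markSum N D (j + 1) F := by
    intro v
    rw [sum_extend v, eq_comm, markSum, Finset.sum_comm]
    refine Finset.sum_congr rfl fun G _ => ?_
    refine Finset.sum_of_injOn (fun w => {w}) (by simp [Set.InjOn]) (by simp) ?_ ?_
    · intro P _ hP
      rw [if_neg]
      rintro ⟨h1, h2⟩
      have h3 := h1.1
      have h4 := (two_le_compSize_iff _ v).1 (by rw [h2]; omega)
      rw [vdeg_extend_self] at h3 h4
      obtain ⟨w, rfl⟩ := Finset.card_eq_one.1 (le_antisymm h3 h4)
      exact hP ⟨w, by simp⟩
    · intro w _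
      simp [isMarked_leaf_iff, compSize_leaf_self, restCount_leaf]
  rw [markSum, Finset.sum_congr rfl fun v _ => key v]
  simp

/-- An isolated mark is removed. -/
lemma markSum_succ_one (N D : ℕ) (F : (ℕ → ℕ) → E) :
    markSum (N + 1) (D + 2) 1 F = (N + 1) • memSum N D F := by
  classical
  have key : ∀ v : Fin (N + 1), (∑ H : SimpleGraph (Fin (N + 1)),
      if IsMarked (D + 2) H v ∧ compSize H v = 1 then F (restCount H v) else 0)
      = memSum N D F := by
    intro v
    rw [sum_extend v, memSum]
    refine Finset.sum_congr rfl fun G _ => ?_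
    rw [Finset.sum_eq_single ∅]
    · simp [isMarked_isolated_iff, compSize_isolated_self, restCount_isolated]
    · intro P _ hP
      rw [if_neg]
      rintro ⟨-, h2⟩
      have h4 := (two_le_compSize_iff (extend v P G) v).2
        (by rw [vdeg_extend_self]; exact Finset.card_pos.2 (Finset.nonempty_iff_ne_empty.2 hP))
      omega
    · simp
  rw [markSum, Finset.sum_congr rfl fun v _ => key v]
  simp

lemma markSum_eq (N D j : ℕ) (F : (ℕ → ℕ) → E) :
    markSum (N + (j + 1)) (D + 2) (j + 1) F
      = ((N + (j + 1)).descFactorial (j + 1)) • memSum N D F := by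
  induction j with
  | zero => rw [zero_add, markSum_succ_one]; simp
  | succ j ih =>
    rw [← add_assoc N (j + 1) 1, markSum_succ_succ, ih, smul_smul, Nat.succ_descFactorial_succ]

lemma markSum_of_lt {N D j : ℕ} (h : N < j) (F : (ℕ → ℕ) → E) : markSum N D j F = 0 := by
  refine Finset.sum_eq_zero fun v _ => Finset.sum_eq_zero fun G _ => if_neg ?_
  rintro ⟨-, h2⟩
  have := compSize_le G v
  omega

/-- In a graph with degrees `1` and `2` the mark can be put at any of the `D` leaves, and the
component of the mark is added back to the counts. -/
lemma sum_markSum (N D : ℕ) (F : (ℕ → ℕ) → E) :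
    ∑ r ∈ Finset.range N, markSum N D (r + 2) (fun u => F (u + Pi.single (r + 2) 1))
      = D • memSum N D F := by
  classical
  simp only [markSum, memSum]
  rw [Finset.sum_comm, Finset.smul_sum]
  simp_rw [Finset.sum_comm (s := Finset.range N)]
  rw [Finset.sum_comm]
  refine Finset.sum_congr rfl fun G _ => ?_
  have key : ∀ v, (∑ r ∈ Finset.range N, if IsMarked D G v ∧ compSize G v = r + 2 then
      F (restCount G v + Pi.single (r + 2) 1) else 0)
      = if IsMem D G ∧ vdeg G v = 1 then F (compCount G) else 0 := by
    intro v
    have hiff := isMarked_and_two_le_iff D v G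
    split_ifs with h'
    · have h := hiff.2 h'
      have := compSize_le G v
      rw [Finset.sum_eq_single (compSize G v - 2)]
      · have h2 : compSize G v - 2 + 2 = compSize G v := by omega
        rw [h2, if_pos ⟨h.1, rfl⟩, ← compCount_eq]
      · intro r _ hr
        rw [if_neg]
        rintro ⟨-, h2⟩
        omega
      · intro hr
        rw [Finset.mem_range] at hr
        omega
    · refine Finset.sum_eq_zero fun r _ => if_neg ?_
      rintro ⟨h1, h2⟩
      exact h' (hiff.1 ⟨h1, by omega⟩)
  rw [Finset.sum_congr rfl fun v _ => key v]
  split_ifs with hG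
  · simp only [hG, true_and]
    rw [← Finset.sum_filter, Finset.sum_const]
    congr 1
    rw [Finset.card_filter, ← hG.2]
    refine Finset.sum_congr rfl fun v _ => ?_
    have := hG.1 v
    split_ifs <;> omega
  · simp [hG]

lemma memSum_of_lt {N D : ℕ} (h : N < D) (F : (ℕ → ℕ) → E) : memSum N D F = 0 := by
  refine Finset.sum_eq_zero fun G _ => if_neg ?_
  rintro ⟨h1, h2⟩
  have : ∑ u, (2 - vdeg G u) ≤ ∑ _u : Fin N, 1 :=
    Finset.sum_le_sum fun u _ => by have := h1 u; omega
  simp at this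
  omega

/-- The peeling recursion: the component of a leaf is a path of some size `r + 2`, there are
`N! / (N - r - 2)!` ways to label it starting from that leaf, and the rest of the graph is
arbitrary. -/
lemma memSum_peel (k m : ℕ) (F : (ℕ → ℕ) → E) :
    (2 * k + 2) • memSum (2 * k + 2 + m) (2 * k + 2) F
      = ∑ r ∈ Finset.range (m + 1), ((2 * k + 2 + m).descFactorial (r + 2)) •
        memSum (2 * k + (m - r)) (2 * k) (fun u => F (u + Pi.single (r + 2) 1)) := by
  rw [← sum_markSum]
  have hsub : Finset.range (m + 1) ⊆ Finset.range (2 * k + 2 + m) :=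
    Finset.range_subset_range.2 (by omega)
  rw [← Finset.sum_subset hsub]
  · refine Finset.sum_congr rfl fun r hr => ?_
    rw [Finset.mem_range] at hr
    have := markSum_eq (2 * k + (m - r)) (2 * k) (r + 1) (fun u => F (u + Pi.single (r + 2) 1))
    rw [show 2 * k + (m - r) + (r + 1 + 1) = 2 * k + 2 + m by omega] at this
    exact this
  · intro r hr hr'
    rw [Finset.mem_range] at hr hr'
    by_cases h : 2 * k + m < r
    · exact markSum_of_lt (by omega) _
    · have := markSum_eq (2 * k + m - r) (2 * k) (r + 1) (fun u => F (u + Pi.single (r + 2) 1))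
      rw [show 2 * k + m - r + (r + 1 + 1) = 2 * k + 2 + m by omega] at this
      rw [this, memSum_of_lt (by omega), smul_zero]

/-! ### The structure of the random graph -/

/-- The number of paths of each size, when path `i` has `a i` inner vertices. -/
def pathCount {k : ℕ} (a : Fin k → ℕ) : ℕ → ℕ := ∑ i, Pi.single (a i + 2) 1

lemma pathCount_insertNth {k : ℕ} (i : Fin (k + 1)) (r : ℕ) (b : Fin k → ℕ) :
    pathCount (i.insertNth (α := fun _ => ℕ) r b) = pathCount b + Pi.single (r + 2) 1 := by
  simp [pathCount, Fin.sum_univ_succAbove _ i, add_comm]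

/-- Compositions, classified by the value `r` of part `i`. -/
lemma sum_antidiagonalTuple_succ {E : Type*} [AddCommMonoid E] {k : ℕ} (i : Fin (k + 1)) (M : ℕ)
    (Φ : (Fin (k + 1) → ℕ) → E) :
    ∑ a ∈ antidiagonalTuple (k + 1) M, Φ a
      = ∑ r ∈ Finset.range (M + 1), ∑ b ∈ antidiagonalTuple k (M - r),
        Φ (i.insertNth (α := fun _ => ℕ) r b) := by
  rw [Finset.sum_sigma']
  symm
  refine Finset.sum_bij' (fun x _ => i.insertNth (α := fun _ => ℕ) x.1 x.2)
    (fun a _ => ⟨a i, fun j => a (i.succAbove j)⟩) ?_ ?_ ?_ ?_ ?_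
  · rintro ⟨r, b⟩ h
    simp only [Finset.mem_sigma, Finset.mem_range, Finset.Nat.mem_antidiagonalTuple] at h ⊢
    rw [Fin.sum_univ_succAbove _ i]
    simp only [Fin.insertNth_apply_same, Fin.insertNth_apply_succAbove]
    omega
  · intro a h
    simp only [Finset.mem_sigma, Finset.mem_range, Finset.Nat.mem_antidiagonalTuple] at h ⊢
    rw [Fin.sum_univ_succAbove _ i] at h
    omega
  · rintro ⟨r, b⟩ h
    simp
  · intro a h
    exact Fin.insertNth_self_removeNth i a
  · simp

/-- The structure of a random graph with degrees `1` and `2`: its paths have the sizes given by a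
composition, and what is left is a `2`-regular graph. -/
lemma memSum_eq_sum_compositions {𝕜 : Type*} [Field 𝕜] [CharZero 𝕜] (k m : ℕ)
    (F : (ℕ → ℕ) → 𝕜) :
    (2 ^ k * k.factorial : ℕ) * memSum (2 * k + m) (2 * k) F / ((2 * k + m).factorial : 𝕜)
      = ∑ l ∈ Finset.range (m + 1), ∑ a ∈ antidiagonalTuple k (m - l),
        memSum l 0 (fun u => F (u + pathCount a)) / (l.factorial : 𝕜) := by
  induction k generalizing m F with
  | zero =>
    rw [Finset.sum_range_succ, Finset.sum_eq_zero]
    · simp [pathCount]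
    · intro l hl
      rw [Finset.mem_range] at hl
      obtain ⟨d, hd⟩ : ∃ d, m - l = d + 1 := ⟨m - l - 1, by omega⟩
      rw [hd, Finset.Nat.antidiagonalTuple_zero_succ, Finset.sum_empty]
  | succ k ih =>
    have hpeel := memSum_peel k m F
    have hN : 2 * (k + 1) + m = 2 * k + 2 + m := by ring
    have hD : 2 * (k + 1) = 2 * k + 2 := by ring
    rw [hN, hD]
    have hf : ((2 * k + 2 + m).factorial : 𝕜) ≠ 0 := by exact_mod_cast Nat.factorial_ne_zero _
    have h1 : ((2 ^ (k + 1) * (k + 1).factorial : ℕ) : 𝕜) * memSum (2 * k + 2 + m) (2 * k + 2) F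
        / ((2 * k + 2 + m).factorial : 𝕜)
        = ∑ r ∈ Finset.range (m + 1), (2 ^ k * k.factorial : ℕ) *
          memSum (2 * k + (m - r)) (2 * k) (fun u => F (u + Pi.single (r + 2) 1))
          / ((2 * k + (m - r)).factorial : 𝕜) := by
      have h2 : ((2 ^ (k + 1) * (k + 1).factorial : ℕ) : 𝕜)
          * memSum (2 * k + 2 + m) (2 * k + 2) F
          = (2 ^ k * k.factorial : ℕ) * ((2 * k + 2) • memSum (2 * k + 2 + m) (2 * k + 2) F) := by
        rw [Nat.factorial_succ, nsmul_eq_mul]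
        push_cast
        ring
      rw [h2, hpeel, Finset.mul_sum, Finset.sum_div]
      refine Finset.sum_congr rfl fun r hr => ?_
      rw [Finset.mem_range] at hr
      have hfac := Nat.factorial_mul_descFactorial (n := 2 * k + 2 + m) (k := r + 2) (by omega)
      rw [show 2 * k + 2 + m - (r + 2) = 2 * k + (m - r) by omega] at hfac
      have hf' : ((2 * k + (m - r)).factorial : 𝕜) ≠ 0 := by
        exact_mod_cast Nat.factorial_ne_zero _
      rw [← hfac] at hf ⊢
      rw [nsmul_eq_mul]
      push_cast at hf ⊢
      have hd := (mul_ne_zero_iff.1 hf).2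
      field_simp
    rw [h1]
    have h3 : ∀ r ∈ Finset.range (m + 1), ((2 ^ k * k.factorial : ℕ) : 𝕜) *
          memSum (2 * k + (m - r)) (2 * k) (fun u => F (u + Pi.single (r + 2) 1))
          / ((2 * k + (m - r)).factorial : 𝕜)
        = ∑ l ∈ Finset.range (m - r + 1), ∑ b ∈ antidiagonalTuple k (m - l - r),
          memSum l 0 (fun u => F (u + pathCount
            (Fin.insertNth (α := fun _ => ℕ) (0 : Fin (k + 1)) r b))) / (l.factorial : 𝕜) := by
      intro r _
      rw [ih]
      refine Finset.sum_congr rfl fun l _ => ?_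
      rw [Nat.sub_right_comm]
      refine Finset.sum_congr rfl fun b _ => ?_
      simp only [pathCount_insertNth, add_assoc]
    rw [Finset.sum_congr rfl h3, Finset.sum_comm' (t' := Finset.range (m + 1))
      (s' := fun l => Finset.range (m - l + 1))]
    · refine Finset.sum_congr rfl fun l _ => ?_
      rw [sum_antidiagonalTuple_succ 0]
    · intro r l
      simp only [Finset.mem_range]
      omega

/-- Deleting a vertex from a `2`-regular graph loses no information, because the neighbours of that
vertex become the two leaves. -/
lemma memSum_zero_le (N : ℕ) :
    memSum (N + 1) 0 (fun _ => (1 : ℝ)) ≤ memSum N 2 (fun _ => (1 : ℝ)) := by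
  classical
  rw [memSum, sum_extend 0, memSum]
  refine Finset.sum_le_sum fun G _ => ?_
  have key : ∀ P, IsMem 0 (extend 0 P G) →
      IsMem 2 G ∧ P = Finset.univ.filter fun x => vdeg G x = 1 := by
    rintro P ⟨h1, h2⟩
    rw [Finset.sum_eq_zero_iff] at h2
    have h3 : ∀ u, vdeg (extend 0 P G) u = 2 := fun u => by
      have := h1 u; have := h2 u (Finset.mem_univ u); omega
    have h4 := h3 0
    have h5 := fun x => h3 (Fin.succAbove 0 x)
    rw [vdeg_extend_self] at h4
    simp only [vdeg_extend_succAbove] at h5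
    refine ⟨⟨fun u => ?_, ?_⟩, ?_⟩
    · have := h5 u; split_ifs at this <;> omega
    · rw [Finset.sum_congr rfl (g := fun x => if x ∈ P then 1 else 0)]
      · simp [h4]
      · intro x _
        have := h5 x; split_ifs at this ⊢ <;> omega
    · ext x
      have := h5 x
      simp only [Finset.mem_filter, Finset.mem_univ, true_and]
      split_ifs at this with hx <;> simp only [hx, true_iff, false_iff] <;> omega
  split_ifs with hG
  · rw [Finset.sum_boole]
    norm_cast
    rw [Finset.card_le_one]
    intro P hP Q hQ
    simp only [Finset.mem_filter, Finset.mem_univ, true_and] at hP hQ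
    rw [(key P hP).2, (key Q hQ).2]
  · exact (Finset.sum_eq_zero fun P _ => if_neg fun h => hG (key P h).1).le

lemma memSum_zero_nonneg (N D : ℕ) : 0 ≤ memSum N D (fun _ => (1 : ℝ)) :=
  Finset.sum_nonneg fun G _ => by split_ifs <;> simp

/-- There are at most `l!` labelled `2`-regular graphs on `l` vertices. -/
lemma memSum_zero_le_factorial (l : ℕ) :
    memSum l 0 (fun _ => (1 : ℝ)) / (l.factorial : ℝ) ≤ 1 := by
  induction l using Nat.strong_induction_on with
  | _ l ih =>
    match l with
    | 0 =>
      classical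
      simp only [memSum]
      simp only [Finset.sum_boole, Nat.factorial_zero, Nat.cast_one, div_one, Nat.cast_le_one]
      refine (Finset.card_le_univ _).trans ?_
      rw [Fintype.card_le_one_iff_subsingleton]
      infer_instance
    | 1 =>
      have := memSum_zero_le 0
      rw [memSum_of_lt (by norm_num : 0 < 2)] at this
      simp
      linarith
    | 2 =>
      have := memSum_zero_le 1
      rw [memSum_of_lt (by norm_num : 1 < 2)] at this
      rw [div_le_one (by positivity)]
      exact this.trans (by positivity)
    | m + 3 =>
      -- a graph with exactly two leaves is one path together with a smaller `2`-regular graph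
      have h1 := memSum_zero_le (m + 2)
      have h2 := memSum_eq_sum_compositions (𝕜 := ℝ) 1 m (fun _ => 1)
      have h3 : ∑ l ∈ Finset.range (m + 1), ∑ a ∈ antidiagonalTuple 1 (m - l),
          memSum l 0 (fun _ => (1 : ℝ)) / (l.factorial : ℝ) ≤ ∑ l ∈ Finset.range (m + 1), 1 := by
        refine Finset.sum_le_sum fun l hl => ?_
        rw [Finset.mem_range] at hl
        simpa using ih l (by omega)
      rw [← h2] at h3
      simp only [Finset.sum_const, Finset.card_range, nsmul_eq_mul, mul_one, pow_one,
        Nat.factorial_one, add_comm 2 m] at h3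
      rw [div_le_iff₀ (by positivity)] at h3 ⊢
      rw [Nat.factorial_succ (m + 2)]
      -- `memSum (m + 2) 2` is at most `(m + 1) / 2` times `(m + 2)!`, and `(m + 1) / 2 ≤ m + 3`
      push_cast at h3 ⊢
      have : (0 : ℝ) ≤ (m + 2).factorial := by positivity
      nlinarith

lemma memSum_zero_zero {E : Type*} [AddCommMonoid E] (F : (ℕ → ℕ) → E) : memSum 0 0 F = F 0 := by
  classical
  rw [memSum, Finset.sum_eq_single ⊥]
  · rw [if_pos ⟨fun u => u.elim0, by simp⟩]
    congr 1
    funext j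
    simp [compCount]
  · intro G _ hG
    exact absurd (Subsingleton.elim _ _) hG
  · simp

/-! ### Uniform compositions and their moments -/

/-- The number of weak compositions of `M` into `k` parts. -/
def numComp (k M : ℕ) : ℕ := (antidiagonalTuple k M).card

/-- The average of `Φ` over the weak compositions of `M` into `k` parts. -/
noncomputable def compMean {𝕜 : Type*} [Field 𝕜] (k M : ℕ) (Φ : (Fin k → ℕ) → 𝕜) : 𝕜 :=
  (∑ a ∈ antidiagonalTuple k M, Φ a) / (numComp k M : 𝕜)

/-- Pólya urn identity: increasing part `i` of a uniform composition of `M` with probability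
proportional to `a i + 1` gives a uniform composition of `M + 1`. -/
lemma sum_antidiagonalTuple_polya {E : Type*} [AddCommMonoid E] (k M : ℕ)
    (Φ : (Fin k → ℕ) → E) :
    (M + 1) • ∑ a ∈ antidiagonalTuple k (M + 1), Φ a
      = ∑ a ∈ antidiagonalTuple k M, ∑ i, (a i + 1) • Φ (a + Pi.single i 1) := by
  have h1 : (M + 1) • ∑ a ∈ antidiagonalTuple k (M + 1), Φ a
      = ∑ a ∈ antidiagonalTuple k (M + 1), ∑ i, a i • Φ a := by
    rw [Finset.smul_sum]
    refine Finset.sum_congr rfl fun a ha => ?_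
    rw [← Finset.sum_smul, Finset.Nat.mem_antidiagonalTuple.1 ha]
  rw [h1, Finset.sum_comm, Finset.sum_comm (s := antidiagonalTuple k M)]
  refine Finset.sum_congr rfl fun i _ => ?_
  symm
  refine Finset.sum_of_injOn (fun a => a + Pi.single i 1)
    (fun a _ b _ h => add_right_cancel h) ?_ ?_ ?_
  · intro a ha
    simp only [Finset.mem_coe, Finset.Nat.mem_antidiagonalTuple] at ha ⊢
    simp [Finset.sum_add_distrib, ha]
  · intro a ha hno
    have h0 : a i = 0 := by
      by_contra h0
      refine hno ⟨a - Pi.single i 1, ?_, ?_⟩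
      · have hle : (Pi.single i 1 : Fin k → ℕ) ≤ a := by
          intro j
          by_cases hj : j = i
          · subst hj; simpa using Nat.one_le_iff_ne_zero.2 h0
          · simp [hj]
        have : ∑ j, (a - Pi.single i 1 : Fin k → ℕ) j
            + ∑ j, (Pi.single i 1 : Fin k → ℕ) j = M + 1 := by
          rw [← Finset.sum_add_distrib, ← Finset.Nat.mem_antidiagonalTuple.1 ha]
          exact Finset.sum_congr rfl fun j _ => Nat.sub_add_cancel (hle j)
        simp only [Finset.mem_coe, Finset.Nat.mem_antidiagonalTuple]
        rw [Finset.sum_pi_single' i 1] at this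
        simpa using this
      · funext j
        by_cases hj : j = i
        · subst hj; simp; omega
        · simp [hj]
    rw [h0, zero_smul]
  · intro a _
    simp

lemma numComp_succ (k M : ℕ) : (M + 1) * numComp k (M + 1) = (M + k) * numComp k M := by
  have h := sum_antidiagonalTuple_polya (E := ℕ) k M (fun _ => 1)
  simp only [smul_eq_mul, mul_one, Finset.sum_const, Finset.sum_add_distrib, Finset.card_univ,
    Fintype.card_fin] at h
  rw [Finset.sum_congr rfl (g := fun _ => M)
    (fun a ha => Finset.Nat.mem_antidiagonalTuple.1 ha)] at h
  rw [numComp, h, numComp]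
  simp
  ring

lemma numComp_parts_succ (k M : ℕ) :
    numComp (k + 1) M = ∑ r ∈ Finset.range (M + 1), numComp k (M - r) := by
  have h := sum_antidiagonalTuple_succ (E := ℕ) (0 : Fin (k + 1)) M (fun _ => 1)
  simpa [numComp] using h

lemma numComp_zero_right (k : ℕ) : numComp k 0 = 1 := by
  simp [numComp, Finset.Nat.antidiagonalTuple_zero_right]

lemma mul_numComp_succ (k M : ℕ) : k * numComp (k + 1) M = (M + k) * numComp k M := by
  induction M with
  | zero => simp [numComp_zero_right]
  | succ M ih =>
    -- Pascal's rule
    have h1 : numComp (k + 1) (M + 1) = numComp (k + 1) M + numComp k (M + 1) := by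
      rw [numComp_parts_succ, Finset.sum_range_succ', numComp_parts_succ]
      simp
    have := numComp_succ k M
    rw [h1, mul_add, ih]
    linarith

lemma numComp_pos (k M : ℕ) : 0 < numComp (k + 1) M := by
  induction M with
  | zero => simp [numComp_zero_right]
  | succ M ih =>
    have := numComp_succ (k + 1) M
    by_contra h
    have h0 : numComp (k + 1) (M + 1) = 0 := by omega
    rw [h0, mul_zero] at this
    have : 0 < (M + (k + 1)) * numComp (k + 1) M := by positivity
    omega

/-- The probability that a given part equals `r`, if `u i` is the conditional probability of
passing the value `i`. -/
noncomputable def geomProd (r : ℕ) (u : ℕ → ℝ) : ℝ := (1 - u r) * ∏ i ∈ Finset.range r, u i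

lemma geomProd_mem {r : ℕ} {u : ℕ → ℝ} (hu : ∀ i, 0 ≤ u i ∧ u i ≤ 1) :
    0 ≤ geomProd r u ∧ geomProd r u ≤ 1 := by
  have h0 : 0 ≤ ∏ i ∈ Finset.range r, u i := Finset.prod_nonneg fun i _ => (hu i).1
  have h1 : ∏ i ∈ Finset.range r, u i ≤ 1 :=
    Finset.prod_le_one (fun i _ => (hu i).1) (fun i _ => (hu i).2)
  have := hu r
  unfold geomProd
  constructor <;> nlinarith

lemma abs_prod_range_sub_le {r : ℕ} {u v : ℕ → ℝ} (hu : ∀ i, 0 ≤ u i ∧ u i ≤ 1)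
    (hv : ∀ i, 0 ≤ v i ∧ v i ≤ 1) :
    |∏ i ∈ Finset.range r, u i - ∏ i ∈ Finset.range r, v i|
      ≤ ∑ i ∈ Finset.range r, |u i - v i| := by
  induction r with
  | zero => simp
  | succ r ih =>
    rw [Finset.prod_range_succ, Finset.prod_range_succ, Finset.sum_range_succ]
    set A := ∏ i ∈ Finset.range r, u i
    set B := ∏ i ∈ Finset.range r, v i
    have h0 : 0 ≤ B := Finset.prod_nonneg fun i _ => (hv i).1
    have h1 : B ≤ 1 := Finset.prod_le_one (fun i _ => (hv i).1) (fun i _ => (hv i).2)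
    calc |A * u r - B * v r| = |(A - B) * u r + B * (u r - v r)| := by ring_nf
      _ ≤ |A - B| * |u r| + |B| * |u r - v r| := by
          rw [← abs_mul, ← abs_mul]; exact abs_add_le _ _
      _ ≤ |A - B| * 1 + 1 * |u r - v r| := by
          gcongr
          · rw [abs_of_nonneg (hu r).1]; exact (hu r).2
          · rwa [abs_of_nonneg h0]
      _ ≤ _ := by linarith

lemma abs_geomProd_sub_le {r : ℕ} {u v : ℕ → ℝ} (hu : ∀ i, 0 ≤ u i ∧ u i ≤ 1)
    (hv : ∀ i, 0 ≤ v i ∧ v i ≤ 1) :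
    |geomProd r u - geomProd r v| ≤ ∑ i ∈ Finset.range (r + 1), |u i - v i| := by
  rw [Finset.sum_range_succ, geomProd, geomProd]
  have h := abs_prod_range_sub_le (r := r) hu hv
  set A := ∏ i ∈ Finset.range r, u i
  set B := ∏ i ∈ Finset.range r, v i
  have h0 : 0 ≤ B := Finset.prod_nonneg fun i _ => (hv i).1
  have h1 : B ≤ 1 := Finset.prod_le_one (fun i _ => (hv i).1) (fun i _ => (hv i).2)
  have h2 := hu r
  calc |(1 - u r) * A - (1 - v r) * B| = |(1 - u r) * (A - B) + B * (v r - u r)| := by ring_nf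
    _ ≤ |1 - u r| * |A - B| + |B| * |v r - u r| := by
        rw [← abs_mul, ← abs_mul]; exact abs_add_le _ _
    _ ≤ 1 * |A - B| + 1 * |v r - u r| := by
        gcongr
        · rw [abs_of_nonneg (by linarith)]; linarith
        · rwa [abs_of_nonneg h0]
    _ ≤ _ := by rw [abs_sub_comm (v r)]; linarith

/-- With `x` units still to be distributed among the current part and `c` further parts, this is the
probability that the current part receives another unit. -/
noncomputable def passProb (c x : ℝ) : ℝ := x / (x + c)

lemma passProb_mem {c x : ℝ} (hc : 0 < c) (hx : 0 ≤ x) :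
    0 ≤ passProb c x ∧ passProb c x ≤ 1 := by
  unfold passProb
  exact ⟨by positivity, by rw [div_le_one (by positivity)]; linarith⟩

lemma abs_passProb_sub_le {c x y : ℝ} (hc : 0 < c) (hx : 0 ≤ x) (hy : 0 ≤ y) :
    |passProb c x - passProb c y| ≤ |x - y| / c := by
  have h : passProb c x - passProb c y = (x - y) / c * (c ^ 2 / ((x + c) * (y + c))) := by
    unfold passProb
    have : x + c ≠ 0 := by positivity
    have : y + c ≠ 0 := by positivity
    field_simp
    ring
  rw [h, abs_mul, abs_div, abs_of_pos hc]
  refine mul_le_of_le_one_right (by positivity) ?_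
  rw [abs_of_nonneg (by positivity), div_le_one (by positivity)]
  nlinarith [mul_nonneg hx hy]

lemma abs_passProb_succ_sub_le {c x : ℝ} (hc : 0 < c) (hx : 0 ≤ x) :
    |passProb c x - passProb (c + 1) x| ≤ 1 / c := by
  have h : passProb c x - passProb (c + 1) x = (x / (x + c)) * (1 / (x + (c + 1))) := by
    unfold passProb
    have : x + c ≠ 0 := by positivity
    have : x + (c + 1) ≠ 0 := by positivity
    field_simp
    ring
  have h2 := (passProb_mem hc hx).2
  unfold passProb at h2
  rw [h, abs_of_nonneg (by positivity)]
  calc _ ≤ 1 * (1 / c) := by gcongr; linarith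
    _ = _ := one_mul _

/-- The probability that a given part of a uniform composition of `M` into `c + 1` parts
equals `r`. -/
noncomputable def partProb (r : ℕ) (c : ℝ) (M : ℕ) : ℝ :=
  geomProd r fun i => passProb c ((M - i : ℕ) : ℝ)

lemma partProb_mem (r : ℕ) {c : ℝ} (hc : 0 < c) (M : ℕ) :
    0 ≤ partProb r c M ∧ partProb r c M ≤ 1 :=
  geomProd_mem fun _ => passProb_mem hc (Nat.cast_nonneg _)

lemma partProb_of_lt {r : ℕ} {c : ℝ} {M : ℕ} (h : M < r) : partProb r c M = 0 := by
  unfold partProb geomProd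
  rw [Finset.prod_eq_zero (Finset.mem_range.2 h), mul_zero]
  simp [passProb]

/-- The proportion of the compositions of `M` into `k + 2` parts that have a given part equal to
`r`. -/
lemma numComp_sub_eq {k r M : ℕ} (h : r ≤ M) :
    (numComp (k + 1) (M - r) : ℝ) = numComp (k + 2) M * partProb r ((k + 1 : ℕ) : ℝ) M := by
  induction r generalizing M with
  | zero =>
    have := mul_numComp_succ (k + 1) M
    have h2 : (((k + 1 : ℕ) : ℝ)) * numComp (k + 2) M = (M + (k + 1 : ℕ)) * numComp (k + 1) M := by
      exact_mod_cast this
    simp only [Nat.sub_zero, partProb, geomProd, Finset.range_zero, Finset.prod_empty, mul_one,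
      passProb]
    have h3 : (M : ℝ) + (k + 1 : ℕ) ≠ 0 := by positivity
    field_simp
    linarith
  | succ r ih =>
    obtain ⟨M, rfl⟩ : ∃ M', M = M' + 1 := ⟨M - 1, by omega⟩
    have h1 := ih (M := M) (by omega)
    have h2 : ((M : ℝ) + 1) * numComp (k + 2) (M + 1)
        = (M + (k + 2 : ℕ)) * numComp (k + 2) M := by
      exact_mod_cast numComp_succ (k + 2) M
    have h3 : partProb (r + 1) ((k + 1 : ℕ) : ℝ) (M + 1)
        = passProb ((k + 1 : ℕ) : ℝ) (M + 1) * partProb r ((k + 1 : ℕ) : ℝ) M := by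
      simp only [partProb, geomProd, Finset.prod_range_succ', Nat.add_sub_add_right, Nat.sub_zero]
      push_cast
      ring
    rw [Nat.add_sub_add_right, h1, h3, passProb, ← mul_assoc]
    congr 1
    have h4 : (M : ℝ) + 1 + (k + 1 : ℕ) ≠ 0 := by positivity
    push_cast at h2 h4 ⊢
    field_simp
    linarith

lemma abs_partProb_sub_le (r : ℕ) {c : ℝ} (hc : 0 < c) (M M' : ℕ) :
    |partProb r c M - partProb r c M'| ≤ (r + 1) * (|(M : ℝ) - M'| / c) := by
  refine (abs_geomProd_sub_le (fun _ => passProb_mem hc (Nat.cast_nonneg _))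
    (fun _ => passProb_mem hc (Nat.cast_nonneg _))).trans ?_
  refine (Finset.sum_le_card_nsmul _ _ (|(M : ℝ) - M'| / c) fun i _ => ?_).trans (by simp)
  refine (abs_passProb_sub_le hc (Nat.cast_nonneg _) (Nat.cast_nonneg _)).trans ?_
  refine div_le_div_of_nonneg_right ?_ hc.le
  have h : |((M - i : ℕ) : ℤ) - ((M' - i : ℕ) : ℤ)| ≤ |(M : ℤ) - M'| := by
    rw [abs_le]
    rcases abs_cases ((M : ℤ) - M') with ⟨h, _⟩ | ⟨h, _⟩ <;> rw [h] <;> omega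
  exact_mod_cast h

lemma abs_partProb_succ_sub_le (r : ℕ) {c : ℝ} (hc : 0 < c) (M : ℕ) :
    |partProb r c (M - r) - partProb r (c + 1) M| ≤ (r + 1) * ((r + 1) / c) := by
  refine (abs_geomProd_sub_le (fun _ => passProb_mem hc (Nat.cast_nonneg _))
    (fun _ => passProb_mem (by positivity) (Nat.cast_nonneg _))).trans ?_
  refine (Finset.sum_le_card_nsmul _ _ (((r : ℝ) + 1) / c) fun i _ => ?_).trans (by simp)
  have h1 := abs_passProb_sub_le (x := ((M - r - i : ℕ) : ℝ)) (y := ((M - i : ℕ) : ℝ)) hc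
    (Nat.cast_nonneg _) (Nat.cast_nonneg _)
  have h2 := abs_passProb_succ_sub_le (x := ((M - i : ℕ) : ℝ)) hc (Nat.cast_nonneg _)
  have h3 : |((M - r - i : ℕ) : ℝ) - ((M - i : ℕ) : ℝ)| ≤ r := by
    have h : |((M - r - i : ℕ) : ℤ) - ((M - i : ℕ) : ℤ)| ≤ r := by
      rw [abs_le]; omega
    exact_mod_cast h
  calc _ ≤ _ := abs_sub_le _ (passProb c ((M - i : ℕ) : ℝ)) _
    _ ≤ r / c + 1 / c := add_le_add (h1.trans (by gcongr)) h2
    _ = _ := by ring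

lemma abs_partProb_sub_geometric_le (r : ℕ) {α c : ℝ} (hα : 0 < α) (hc : 0 < c) (M : ℕ) :
    |partProb r c M - 1 / (1 + α) * (α / (1 + α)) ^ r| ≤ (r + 1) * ((|M - α * c| + r) / c) := by
  have hq : ∀ i : ℕ, passProb c (α * c) = α / (1 + α) := fun _ => by
    unfold passProb; field_simp; ring
  have h : 1 / (1 + α) * (α / (1 + α)) ^ r = geomProd r fun i => passProb c (α * c) := by
    unfold geomProd
    rw [hq 0, Finset.prod_const, Finset.card_range]
    congr 1
    field_simp
    ring
  rw [h]
  refine (abs_geomProd_sub_le (fun _ => passProb_mem hc (Nat.cast_nonneg _))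
    (fun _ => passProb_mem hc (by positivity))).trans ?_
  refine (Finset.sum_le_card_nsmul _ _ ((|M - α * c| + r) / c) fun i hi => ?_).trans (by simp)
  refine (abs_passProb_sub_le hc (Nat.cast_nonneg _) (by positivity)).trans ?_
  gcongr
  rw [Finset.mem_range] at hi
  have h3 : |((M - i : ℕ) : ℝ) - M| ≤ r := by
    have h : |((M - i : ℕ) : ℤ) - (M : ℤ)| ≤ r := by
      rw [abs_le]; omega
    exact_mod_cast h
  have := abs_sub_le ((M - i : ℕ) : ℝ) M (α * c)
  linarith

/-- Size biasing: a part equal to `r` can be removed from any of the `k + 1` positions. -/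
lemma sum_pathCount_mul {𝕜 : Type*} [Field 𝕜] (k M r : ℕ) (Ψ : (ℕ → ℕ) → 𝕜) :
    ∑ a ∈ antidiagonalTuple (k + 1) M, (pathCount a (r + 2) : 𝕜) * Ψ (pathCount a)
      = if r ≤ M then (k + 1 : 𝕜) * ∑ b ∈ antidiagonalTuple k (M - r),
          Ψ (pathCount b + Pi.single (r + 2) 1) else 0 := by
  have h1 : ∀ a : Fin (k + 1) → ℕ, (pathCount a (r + 2) : 𝕜) * Ψ (pathCount a)
      = ∑ i, if a i = r then Ψ (pathCount a) else 0 := by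
    intro a
    simp only [pathCount, Finset.sum_apply, Nat.cast_sum, Finset.sum_mul]
    refine Finset.sum_congr rfl fun i _ => ?_
    by_cases h : a i = r
    · simp [h]
    · simp [h, Ne.symm h]
  simp only [h1]
  rw [Finset.sum_comm]
  have h2 : ∀ i : Fin (k + 1), (∑ a ∈ antidiagonalTuple (k + 1) M,
      if a i = r then Ψ (pathCount a) else 0)
      = if r ≤ M then ∑ b ∈ antidiagonalTuple k (M - r),
          Ψ (pathCount b + Pi.single (r + 2) 1) else 0 := by
    intro i
    rw [sum_antidiagonalTuple_succ i]
    simp only [Fin.insertNth_apply_same, pathCount_insertNth]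
    split_ifs with h
    · rw [Finset.sum_eq_single r]
      · simp
      · intro b _ hb
        simp [hb]
      · intro hr
        rw [Finset.mem_range] at hr
        omega
    · refine Finset.sum_eq_zero fun b hb => Finset.sum_eq_zero fun _ _ => if_neg ?_
      rw [Finset.mem_range] at hb
      omega
  rw [Finset.sum_congr rfl fun i _ => h2 i]
  simp

lemma numComp_ne_zero {𝕜 : Type*} [Field 𝕜] [CharZero 𝕜] (k M : ℕ) :
    (numComp (k + 1) M : 𝕜) ≠ 0 := by
  exact_mod_cast (numComp_pos k M).ne'

lemma sum_pathCount (k M r : ℕ) :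
    ∑ a ∈ antidiagonalTuple (k + 2) M, (pathCount a (r + 2) : ℝ)
      = (k + 2) * partProb r ((k + 1 : ℕ) : ℝ) M * numComp (k + 2) M := by
  have h := sum_pathCount_mul (𝕜 := ℝ) (k + 1) M r (fun _ => 1)
  simp only [mul_one] at h
  rw [h]
  split_ifs with hr
  · simp only [Finset.sum_const, nsmul_eq_mul, mul_one]
    rw [← numComp, numComp_sub_eq hr]
    push_cast
    ring
  · rw [partProb_of_lt (by omega)]
    simp

lemma compMean_pathCount (k M r : ℕ) :
    compMean (k + 2) M (fun a => (pathCount a (r + 2) : ℝ))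
      = (k + 2) * partProb r ((k + 1 : ℕ) : ℝ) M := by
  rw [compMean, sum_pathCount, mul_div_assoc, div_self (numComp_ne_zero _ _), mul_one]

/-- The counts of parts in a uniform composition have variance of linear order: distinct parts are
correlated only to the order of the inverse number of parts. -/
lemma compMean_sq_le (k M r : ℕ) :
    compMean (𝕜 := ℝ) (k + 3) M (fun a => ((pathCount a (r + 2) : ℝ)
      - (k + 3) * partProb r ((k + 2 : ℕ) : ℝ) M) ^ 2) ≤ (1 + 2 * (r + 1) ^ 2) * (k + 3) := by
  set P := partProb r ((k + 2 : ℕ) : ℝ) M with hP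
  have hPm := partProb_mem r (c := ((k + 2 : ℕ) : ℝ)) (by positivity) M
  rw [← hP] at hPm
  have hn : (0 : ℝ) < numComp (k + 3) M := by exact_mod_cast numComp_pos (k + 2) M
  have h1 : ∑ a ∈ antidiagonalTuple (k + 3) M, (pathCount a (r + 2) : ℝ) * pathCount a (r + 2)
      ≤ (k + 3) * numComp (k + 3) M * P * (1 + (k + 2) * P + 2 * (r + 1) ^ 2) := by
    rw [sum_pathCount_mul (𝕜 := ℝ) (k + 2) M r (fun u => (u (r + 2) : ℝ))]
    split_ifs with hr
    · have hn2 := numComp_sub_eq (k := k + 1) hr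
      have hs := sum_pathCount k (M - r) r
      have hlip := abs_partProb_succ_sub_le r (c := ((k + 1 : ℕ) : ℝ)) (by positivity) M
      rw [show ((k + 1 : ℕ) : ℝ) + 1 = ((k + 2 : ℕ) : ℝ) by push_cast; ring, ← hP] at hlip
      set P' := partProb r ((k + 1 : ℕ) : ℝ) (M - r)
      simp only [Pi.add_apply, Pi.single_eq_same, Nat.cast_add, Nat.cast_one,
        Finset.sum_add_distrib, Finset.sum_const, nsmul_eq_mul, mul_one]
      rw [← numComp, show k + 1 + 1 = k + 2 from rfl, hs, hn2]
      rw [show k + 1 + 1 = k + 2 from rfl, ← hP] at *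
      have h4 : ((k : ℝ) + 2) * P' ≤ (k + 2) * P + 2 * (r + 1) ^ 2 := by
        have h5 : ((k : ℝ) + 2) * (P' - P) ≤ (k + 2) * ((r + 1) * ((r + 1) / (k + 1))) := by
          have := (abs_le.1 hlip).2
          push_cast at this
          gcongr
        have h6 : ((k : ℝ) + 2) * ((r + 1) * ((r + 1) / (k + 1))) ≤ 2 * (r + 1) ^ 2 := by
          have : ((k : ℝ) + 2) * ((r + 1) * ((r + 1) / (k + 1)))
              = (k + 2) / (k + 1) * (r + 1) ^ 2 := by ring
          rw [this]
          gcongr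
          rw [div_le_iff₀ (by positivity)]
          linarith
        linarith
      have h7 : (0 : ℝ) ≤ (k + 3) * numComp (k + 3) M * P := by
        have := hPm.1; positivity
      calc _ = ((k : ℝ) + 3) * numComp (k + 3) M * P * (1 + (k + 2) * P') := by
            push_cast; ring
        _ ≤ _ := by
            refine mul_le_mul_of_nonneg_left ?_ h7
            linarith
    · have : P = 0 := partProb_of_lt (by omega)
      simp [this]
  have h2 := sum_pathCount (k + 1) M r
  rw [show k + 1 + 1 = k + 2 from rfl, ← hP] at h2
  rw [compMean, div_le_iff₀ hn]
  have h3 : ∑ a ∈ antidiagonalTuple (k + 3) M, ((pathCount a (r + 2) : ℝ) - (k + 3) * P) ^ 2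
      = ∑ a ∈ antidiagonalTuple (k + 3) M, (pathCount a (r + 2) : ℝ) * pathCount a (r + 2)
        - 2 * ((k + 3) * P) * ∑ a ∈ antidiagonalTuple (k + 3) M, (pathCount a (r + 2) : ℝ)
        + ((k + 3) * P) ^ 2 * numComp (k + 3) M := by
    rw [Finset.mul_sum, ← Finset.sum_sub_distrib, numComp, mul_comm (_ ^ 2), ← nsmul_eq_mul,
      ← Finset.sum_const, ← Finset.sum_add_distrib]
    exact Finset.sum_congr rfl fun a _ => by ring
  rw [h3, show k + 3 = k + 1 + 2 from rfl, h2]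
  have h8 : (0 : ℝ) ≤ (k + 3) * numComp (k + 3) M := by positivity
  have h9 : (0 : ℝ) ≤ (k + 3) * numComp (k + 3) M * (1 + 2 * (r + 1) ^ 2) := by positivity
  push_cast
  have e : k + 1 + 2 = k + 3 := rfl
  rw [e] at *
  nlinarith [mul_nonneg h8 (sq_nonneg P), mul_nonneg h9 (sub_nonneg.2 hPm.2)]

/-! ### Averages over compositions -/

section compMean
variable {𝕜 : Type*} {k M : ℕ}

lemma compMean_add [Field 𝕜] (Φ Ψ : (Fin k → ℕ) → 𝕜) :
    compMean k M (fun a => Φ a + Ψ a) = compMean k M Φ + compMean k M Ψ := by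
  simp [compMean, Finset.sum_add_distrib, add_div]

lemma compMean_sub [Field 𝕜] (Φ Ψ : (Fin k → ℕ) → 𝕜) :
    compMean k M (fun a => Φ a - Ψ a) = compMean k M Φ - compMean k M Ψ := by
  simp [compMean, Finset.sum_sub_distrib, sub_div]

lemma compMean_sum [Field 𝕜] {ι : Type*} (s : Finset ι) (Φ : ι → (Fin k → ℕ) → 𝕜) :
    compMean k M (fun a => ∑ i ∈ s, Φ i a) = ∑ i ∈ s, compMean k M (Φ i) := by
  simp only [compMean]
  rw [Finset.sum_comm, Finset.sum_div]

lemma compMean_const_mul [Field 𝕜] (c : 𝕜) (Φ : (Fin k → ℕ) → 𝕜) :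
    compMean k M (fun a => c * Φ a) = c * compMean k M Φ := by
  simp [compMean, ← Finset.mul_sum, mul_div_assoc]

lemma compMean_const [Field 𝕜] [CharZero 𝕜] (hk : k ≠ 0) (c : 𝕜) :
    compMean k M (fun _ => c) = c := by
  obtain ⟨k, rfl⟩ := Nat.exists_eq_succ_of_ne_zero hk
  have := numComp_ne_zero (𝕜 := 𝕜) k M
  simp only [compMean, Finset.sum_const, nsmul_eq_mul]
  rw [← numComp, mul_comm, mul_div_assoc, div_self this, mul_one]

lemma compMean_mono {Φ Ψ : (Fin k → ℕ) → ℝ} (h : ∀ a ∈ antidiagonalTuple k M, Φ a ≤ Ψ a) :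
    compMean k M Φ ≤ compMean k M Ψ :=
  div_le_div_of_nonneg_right (Finset.sum_le_sum h) (Nat.cast_nonneg _)

lemma norm_compMean_le [RCLike 𝕜] (Φ : (Fin k → ℕ) → 𝕜) :
    ‖compMean k M Φ‖ ≤ compMean k M (fun a => ‖Φ a‖) := by
  rw [compMean, norm_div, RCLike.norm_natCast]
  exact div_le_div_of_nonneg_right (norm_sum_le _ _) (Nat.cast_nonneg _)

lemma compMean_succ [Field 𝕜] [CharZero 𝕜] (hk : k ≠ 0) (Φ : (Fin k → ℕ) → 𝕜) :
    compMean k (M + 1) Φ = compMean k M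
      (fun a => ∑ i, ((a i : 𝕜) + 1) / (M + k) * Φ (a + Pi.single i 1)) := by
  obtain ⟨k, rfl⟩ := Nat.exists_eq_succ_of_ne_zero hk
  have h1 := numComp_ne_zero (𝕜 := 𝕜) k M
  have h2 := numComp_ne_zero (𝕜 := 𝕜) k (M + 1)
  have h3 : ((M : 𝕜) + 1) * numComp (k + 1) (M + 1) = (M + (k + 1 : ℕ)) * numComp (k + 1) M := by
    exact_mod_cast numComp_succ (k + 1) M
  have h4 := sum_antidiagonalTuple_polya (k + 1) M Φ
  have h5 : (M : 𝕜) + (k + 1 : ℕ) ≠ 0 := by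
    have : (M + (k + 1) : ℕ) ≠ 0 := by omega
    exact_mod_cast this
  have h6 : (M : 𝕜) + 1 ≠ 0 := by exact_mod_cast Nat.succ_ne_zero M
  have h7 : ∑ a ∈ antidiagonalTuple (k + 1) M, ∑ i, (a i + 1) • Φ (a + Pi.single i 1)
      = (M + (k + 1 : ℕ)) * ∑ a ∈ antidiagonalTuple (k + 1) M,
        ∑ i, ((a i : 𝕜) + 1) / (M + (k + 1 : ℕ)) * Φ (a + Pi.single i 1) := by
    rw [Finset.mul_sum]
    refine Finset.sum_congr rfl fun a _ => ?_
    rw [Finset.mul_sum]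
    refine Finset.sum_congr rfl fun i _ => ?_
    rw [nsmul_eq_mul]
    push_cast at h5 ⊢
    field_simp
  rw [h7, nsmul_eq_mul] at h4
  rw [compMean, compMean, div_eq_div_iff h2 h1]
  refine mul_left_cancel₀ (mul_ne_zero h6 h5) ?_
  push_cast at h4 h3 ⊢
  linear_combination (numComp (k + 1) M : 𝕜) * ((M : 𝕜) + (k + 1)) * h4
    - (∑ a ∈ antidiagonalTuple (k + 1) M,
        ∑ i, ((a i : 𝕜) + 1) / (M + (k + 1)) * Φ (a + Pi.single i 1)) * ((M : 𝕜) + (k + 1)) * h3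

/-- The mean absolute deviation, by the second moment bound and `2 |x| ≤ x ^ 2 / √k + √k`. -/
lemma compMean_abs_le {k : ℕ} (hk : 3 ≤ k) (M r : ℕ) :
    compMean (𝕜 := ℝ) k M (fun a => |(pathCount a (r + 2) : ℝ) - k * partProb r (k - 1) M|)
      ≤ (1 + (r + 1) ^ 2) * √k := by
  obtain ⟨n, rfl⟩ : ∃ n, k = n + 3 := ⟨k - 3, by omega⟩
  have hs : 0 < √((n + 3 : ℕ) : ℝ) := Real.sqrt_pos.2 (by positivity)
  have hss : √((n + 3 : ℕ) : ℝ) * √((n + 3 : ℕ) : ℝ) = n + 3 := by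
    rw [Real.mul_self_sqrt (by positivity)]; push_cast; ring
  have h := compMean_sq_le n M r
  have hc : ((n + 3 : ℕ) : ℝ) - 1 = ((n + 2 : ℕ) : ℝ) := by push_cast; ring
  rw [hc]
  set s := √((n + 3 : ℕ) : ℝ)
  have h2 : compMean (𝕜 := ℝ) (n + 3) M (fun a => |(pathCount a (r + 2) : ℝ)
      - (n + 3 : ℕ) * partProb r ((n + 2 : ℕ) : ℝ) M|)
      ≤ compMean (𝕜 := ℝ) (n + 3) M (fun a => (1 / (2 * s)) * ((pathCount a (r + 2) : ℝ)
      - (n + 3) * partProb r ((n + 2 : ℕ) : ℝ) M) ^ 2 + s / 2) := by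
    refine compMean_mono fun a _ => ?_
    push_cast
    set x := (pathCount a (r + 2) : ℝ) - (n + 3) * partProb r ((n : ℝ) + 2) M
    have h3 : 1 / (2 * s) * x ^ 2 + s / 2 - |x| = (|x| - s) ^ 2 / (2 * s) := by
      rw [← sq_abs x]; field_simp; ring
    have h4 : 0 ≤ (|x| - s) ^ 2 / (2 * s) := by positivity
    linarith
  refine h2.trans ?_
  rw [compMean_add, compMean_const_mul, compMean_const (by omega)]
  calc _ ≤ 1 / (2 * s) * ((1 + 2 * (r + 1) ^ 2) * (n + 3)) + s / 2 := by gcongr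
    _ = (1 + (r + 1) ^ 2) * s := by rw [← hss]; field_simp; ring

/-- The law of large numbers for the counts of parts, with a rate that is uniform in `M`. -/
lemma exists_compMean_abs_sub_le {α : ℝ} (hα : 0 < α) (r : ℕ) :
    ∃ C : ℝ, 0 ≤ C ∧ ∀ k M : ℕ, 3 ≤ k →
      compMean (𝕜 := ℝ) k M (fun a => |(pathCount a (r + 2) : ℝ) / (M + k)
        - (1 / (1 + α)) ^ 2 * (α / (1 + α)) ^ r|) ≤ C * (1 / √k + |M - α * k| / k) := by
  refine ⟨(1 + (r + 1) ^ 2) + (r + 1) * 2 * (1 + α + r) + 1, by positivity, fun k M hk => ?_⟩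
  have hk0 : (3 : ℝ) ≤ k := by exact_mod_cast hk
  have hkp : (0 : ℝ) < k := by linarith
  have hs : 0 < √(k : ℝ) := Real.sqrt_pos.2 hkp
  have hss : √(k : ℝ) * √(k : ℝ) = k := Real.mul_self_sqrt hkp.le
  set p := 1 / (1 + α) with hp
  set P := partProb r (k - 1) M with hPdef
  set d := p * (α / (1 + α)) ^ r with hd
  have hp1 : 0 ≤ p ∧ p ≤ 1 := ⟨by positivity, by rw [hp, div_le_one (by positivity)]; linarith⟩
  have hq1 : 0 ≤ α / (1 + α) ∧ α / (1 + α) ≤ 1 :=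
    ⟨by positivity, by rw [div_le_one (by positivity)]; linarith⟩
  have hd1 : 0 ≤ d ∧ d ≤ 1 :=
    ⟨by positivity, mul_le_one₀ hp1.2 (by positivity) (pow_le_one₀ hq1.1 hq1.2)⟩
  have h1 := compMean_abs_le hk M r
  have h2 : |P - d| ≤ (r + 1) * 2 * (1 + α + r) * (1 / √k + |M - α * k| / k) := by
    have h3 := abs_partProb_sub_geometric_le r hα (c := (k : ℝ) - 1) (by linarith) M
    refine h3.trans ?_
    have h4 : |M - α * (k - 1)| ≤ |M - α * k| + α := by
      have := abs_add_le ((M : ℝ) - α * k) α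
      rw [abs_of_pos hα] at this
      rwa [show (M : ℝ) - α * (k - 1) = M - α * k + α by ring]
    have h5 : (|M - α * (k - 1)| + r) / (k - 1) ≤ 2 * (|M - α * k| + α + r) / k := by
      rw [div_le_div_iff₀ (by linarith) hkp]
      have : 0 ≤ |M - α * (k - 1)| := abs_nonneg _
      have hr : (0 : ℝ) ≤ r := by positivity
      nlinarith
    have h6 : (1 : ℝ) / k ≤ 1 / √k := by
      have h1s : 1 ≤ √(k : ℝ) := Real.one_le_sqrt.2 (by linarith)
      exact one_div_le_one_div_of_le hs (by nlinarith)
    have h7 : 0 ≤ |M - α * k| / k := by positivity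
    calc _ ≤ (r + 1) * (2 * (|M - α * k| + α + r) / k) := by gcongr
      _ = (r + 1) * 2 * (|M - α * k| / k + (α + r) * (1 / k)) := by ring
      _ ≤ (r + 1) * 2 * ((1 + α + r) * (|M - α * k| / k) + (1 + α + r) * (1 / √k)) := by
          gcongr
          · have : (0 : ℝ) ≤ α + r := by positivity
            nlinarith
          · linarith
      _ = _ := by ring
  have h3 : |(k : ℝ) / (M + k) - p| ≤ |M - α * k| / k := by
    have h4 : (k : ℝ) / (M + k) - p = (α * k - M) / ((M + k) * (1 + α)) := by
      rw [hp]; field_simp; ring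
    rw [h4, abs_div, abs_sub_comm]
    refine div_le_div_of_nonneg_left (abs_nonneg _) hkp ?_
    rw [abs_of_nonneg (by positivity)]
    have : (0 : ℝ) ≤ M := by positivity
    nlinarith [mul_nonneg this hα.le, mul_nonneg hkp.le hα.le]
  have hMk : (0 : ℝ) < M + k := by positivity
  have key : ∀ a : Fin k → ℕ, |(pathCount a (r + 2) : ℝ) / (M + k) - p ^ 2 * (α / (1 + α)) ^ r|
      ≤ (1 / k) * |(pathCount a (r + 2) : ℝ) - k * P| + (|P - d| + |(k : ℝ) / (M + k) - p|) := by
    intro a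
    have e : (pathCount a (r + 2) : ℝ) / (M + k) - p ^ 2 * (α / (1 + α)) ^ r
        = ((pathCount a (r + 2) : ℝ) - k * P) / (M + k) + (k / (M + k)) * (P - d)
          + ((k : ℝ) / (M + k) - p) * d := by
      rw [hd]; field_simp; ring
    rw [e]
    refine (abs_add_three _ _ _).trans ?_
    rw [abs_div, abs_mul, abs_mul, abs_of_pos hMk, abs_of_nonneg hd1.1,
      abs_of_nonneg (by positivity : (0 : ℝ) ≤ k / (M + k))]
    have h8 : (k : ℝ) / (M + k) ≤ 1 := by
      rw [div_le_one hMk]; have : (0 : ℝ) ≤ M := by positivity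
      linarith
    have h9 : |(pathCount a (r + 2) : ℝ) - k * P| / (M + k)
        ≤ (1 / k) * |(pathCount a (r + 2) : ℝ) - k * P| := by
      rw [one_div_mul_eq_div]
      refine div_le_div_of_nonneg_left (abs_nonneg _) hkp ?_
      have : (0 : ℝ) ≤ M := by positivity
      linarith
    have h10 : (k : ℝ) / (M + k) * |P - d| ≤ |P - d| := mul_le_of_le_one_left (abs_nonneg _) h8
    have h11 : |(k : ℝ) / (M + k) - p| * d ≤ |(k : ℝ) / (M + k) - p| :=
      mul_le_of_le_one_right (abs_nonneg _) hd1.2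
    linarith
  refine (compMean_mono fun a _ => key a).trans ?_
  rw [compMean_add, compMean_const_mul, compMean_const (by omega)]
  have h12 : (1 : ℝ) / k * ((1 + (r + 1) ^ 2) * √k) = (1 + (r + 1) ^ 2) * (1 / √k) := by
    nth_rewrite 1 [← hss]
    field_simp
  have h13 : (1 : ℝ) / k * compMean (𝕜 := ℝ) k M (fun a => |(pathCount a (r + 2) : ℝ) - k * P|)
      ≤ (1 + (r + 1) ^ 2) * (1 / √k) := by
    rw [← h12]; gcongr
  have h14 : 0 ≤ |M - α * k| / k := by positivity
  have h15 : 0 ≤ 1 / √(k : ℝ) := by positivity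
  have h16 : (0 : ℝ) ≤ (r + 1) ^ 2 := by positivity
  nlinarith

end compMean

/-! ### The characteristic function of a composition and the urn step -/

lemma norm_exp_mul_I_sub_le (x : ℝ) :
    ‖Complex.exp (x * Complex.I) - 1 - x * Complex.I‖ ≤ 3 * x ^ 2 := by
  have hn : ‖(x : ℂ) * Complex.I‖ = |x| := by simp
  rcases le_or_gt |x| 1 with h | h
  · have := Complex.norm_exp_sub_one_sub_id_le (x := x * Complex.I) (by rw [hn]; exact h)
    rw [hn, sq_abs] at this
    nlinarith [sq_nonneg x]
  · have h1 : ‖Complex.exp (x * Complex.I) - 1 - x * Complex.I‖ ≤ 1 + 1 + |x| := by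
      refine (norm_sub_le _ _).trans (add_le_add ((norm_sub_le _ _).trans ?_) hn.le)
      rw [Complex.norm_exp_ofReal_mul_I, norm_one]
    rw [← sq_abs]
    nlinarith

lemma sum_comp_eq_sum_pathCount {k R : ℕ} {f : ℕ → ℝ} (hf : ∀ r, R ≤ r → f r = 0)
    (a : Fin k → ℕ) : ∑ i, f (a i) = ∑ r ∈ Finset.range R, f r * pathCount a (r + 2) := by
  simp only [pathCount, Finset.sum_apply, Nat.cast_sum, Finset.mul_sum]
  rw [Finset.sum_comm]
  refine Finset.sum_congr rfl fun i _ => ?_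
  by_cases h : a i < R
  · rw [Finset.sum_eq_single (a i)]
    · simp
    · intro r _ hr
      simp [hr]
    · intro h'
      exact absurd (Finset.mem_range.2 h) h'
  · rw [hf _ (not_lt.1 h), Finset.sum_eq_zero]
    intro r hr
    rw [Finset.mem_range] at hr
    have : r ≠ a i := by omega
    simp [this]

/-- The slope of the linear regression of `ϑ X` on `X`, for a geometric variable `X` of mean `α`,
after a summation by parts. It is the derivative in `M` of the mean of `∑ i, ϑ (a i)` over the
compositions of `M`. -/
noncomputable def slope (α : ℝ) (R : ℕ) (ϑ : ℕ → ℝ) : ℝ :=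
  ∑ r ∈ Finset.range R, (r + 1) * (ϑ (r + 1) - ϑ r) * ((1 / (1 + α)) ^ 2 * (α / (1 + α)) ^ r)

/-- The residual of that regression. -/
noncomputable def residual (α : ℝ) (R : ℕ) (ϑ : ℕ → ℝ) (s : ℕ) : ℝ :=
  ϑ s - ∑ r ∈ Finset.range R, ϑ r * (1 / (1 + α) * (α / (1 + α)) ^ r) - slope α R ϑ * (s - α)

/-- The characteristic function at `1 / √k` of the sum of `ξ` over the parts of a uniform
composition of `M` into `k` parts. -/
noncomputable def compCharFun (ξ : ℕ → ℝ) (k M : ℕ) : ℂ :=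
  compMean k M fun a => Complex.exp (((∑ i, ξ (a i)) / √k : ℝ) * Complex.I)

lemma sum_comp_add_single {k : ℕ} (ξ : ℕ → ℝ) (a : Fin k → ℕ) (i : Fin k) :
    ∑ j, ξ ((a + Pi.single i 1 : Fin k → ℕ) j) = ∑ j, ξ (a j) + (ξ (a i + 1) - ξ (a i)) := by
  rw [← Finset.add_sum_erase _ _ (Finset.mem_univ i),
    ← Finset.add_sum_erase (f := fun j => ξ (a j)) _ (Finset.mem_univ i)]
  rw [Finset.sum_congr rfl (g := fun j => ξ (a j)) (s₁ := Finset.univ.erase i)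
    (fun j hj => by simp [Finset.ne_of_mem_erase hj])]
  simp only [Pi.add_apply, Pi.single_eq_same]
  ring

/-- One urn step moves the characteristic function by little, since the subtracted slope cancels
the drift. -/
lemma exists_norm_compCharFun_succ_sub_le {α : ℝ} (hα : 0 < α) {R : ℕ} {ϑ : ℕ → ℝ}
    (hϑ : ∀ r, R ≤ r → ϑ r = 0) :
    ∃ C : ℝ, 0 ≤ C ∧ ∀ k M : ℕ, 3 ≤ k →
      ‖compCharFun (residual α R ϑ) k (M + 1) - compCharFun (residual α R ϑ) k M‖
        ≤ C * (1 / k + |M - α * k| / (k * √k)) := by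
  choose C hC0 hC using fun r => exists_compMean_abs_sub_le hα r
  set b := slope α R ϑ with hb
  set ξ := residual α R ϑ with hξ
  set T := ∑ r ∈ Finset.range R, |ϑ r| with hT
  have hT' : ∀ r, |ϑ r| ≤ T := by
    intro r
    by_cases hr : r < R
    · exact Finset.single_le_sum (f := fun r => |ϑ r|) (fun _ _ => abs_nonneg _)
        (Finset.mem_range.2 hr)
    · rw [hϑ r (not_lt.1 hr), abs_zero]
      exact Finset.sum_nonneg fun _ _ => abs_nonneg _
  set B := 2 * T + |b| with hB
  have hT0 : 0 ≤ T := (abs_nonneg _).trans (hT' 0)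
  have hB0 : 0 ≤ B := by positivity
  -- part `i` grows with probability proportional to `a i + 1`, so `c r` is the drift contributed
  -- by a part equal to `r`
  set c : ℕ → ℝ := fun r => (r + 1) * (ϑ (r + 1) - ϑ r) with hc
  set K := ∑ r ∈ Finset.range R, |c r| * C r with hK
  have hK0 : 0 ≤ K := Finset.sum_nonneg fun r _ => mul_nonneg (abs_nonneg _) (hC0 r)
  refine ⟨3 * B ^ 2 + K, by positivity, fun k M hk => ?_⟩
  have hkp : (0 : ℝ) < k := by
    have : 0 < k := by omega
    exact_mod_cast this
  have hs : 0 < √(k : ℝ) := Real.sqrt_pos.2 hkp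
  have hss : √(k : ℝ) * √(k : ℝ) = k := Real.mul_self_sqrt hkp.le
  have hMk : (0 : ℝ) < M + k := by positivity
  set δ : ℕ → ℝ := fun s => ξ (s + 1) - ξ s with hδ
  have hδe : ∀ s, δ s = ϑ (s + 1) - ϑ s - b := by
    intro s; simp only [hδ, hξ, residual, ← hb]; push_cast; ring
  have hδB : ∀ s, |δ s| ≤ B := by
    intro s
    rw [hδe]
    have h1 := abs_sub (ϑ (s + 1) - ϑ s) b
    have h2 := abs_sub (ϑ (s + 1)) (ϑ s)
    have := hT' s; have := hT' (s + 1)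
    linarith
  have hw : ∀ a ∈ antidiagonalTuple k M, ∑ i, ((a i : ℝ) + 1) / (M + k) = 1 := by
    intro a ha
    rw [← Finset.sum_div, Finset.sum_add_distrib, ← Nat.cast_sum,
      Finset.Nat.mem_antidiagonalTuple.1 ha]
    simp only [Finset.sum_const, Finset.card_univ, Fintype.card_fin, nsmul_eq_mul, mul_one]
    exact div_self hMk.ne'
  -- the slope is the mean of `c` under the limiting frequencies of the parts, so the drift of
  -- `ξ` only involves the deviations of the frequencies
  have hdrift : ∀ a ∈ antidiagonalTuple k M, |∑ i, ((a i : ℝ) + 1) / (M + k) * δ (a i)|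
      ≤ ∑ r ∈ Finset.range R, |c r| * |(pathCount a (r + 2) : ℝ) / (M + k)
        - (1 / (1 + α)) ^ 2 * (α / (1 + α)) ^ r| := by
    intro a ha
    have h1 : ∑ i, ((a i : ℝ) + 1) / (M + k) * δ (a i)
        = ∑ r ∈ Finset.range R, c r * ((pathCount a (r + 2) : ℝ) / (M + k)
        - (1 / (1 + α)) ^ 2 * (α / (1 + α)) ^ r) := by
      have h2 : ∑ i, ((a i : ℝ) + 1) / (M + k) * δ (a i)
          = (∑ i, c (a i)) / (M + k) - b * ∑ i, ((a i : ℝ) + 1) / (M + k) := by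
        rw [Finset.sum_div, Finset.mul_sum, ← Finset.sum_sub_distrib]
        refine Finset.sum_congr rfl fun i _ => ?_
        rw [hδe, hc]
        ring
      have h3 : ∀ r, R ≤ r → c r = 0 := fun r hr => by
        simp [hc, hϑ r hr, hϑ (r + 1) (by omega)]
      rw [h2, hw a ha, sum_comp_eq_sum_pathCount h3, hb, slope, mul_one, Finset.sum_div,
        ← Finset.sum_sub_distrib]
      exact Finset.sum_congr rfl fun r _ => by simp only [hc]; ring
    rw [h1]
    exact (Finset.abs_sum_le_sum_abs _ _).trans_eq (Finset.sum_congr rfl fun r _ => abs_mul _ _)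
  set F : (Fin k → ℕ) → ℂ := fun a =>
    Complex.exp (((∑ i, ξ (a i)) / √k : ℝ) * Complex.I) with hF
  -- the second-order remainder of the exponential is `O(1 / k)`; the first-order term is the drift
  have hpoint : ∀ a ∈ antidiagonalTuple k M,
      ‖(∑ i, ((a i : ℂ) + 1) / (M + k) * F (a + Pi.single i 1)) - F a‖
      ≤ 3 * B ^ 2 * (1 / k) + (1 / √k) * ∑ r ∈ Finset.range R, |c r| *
        |(pathCount a (r + 2) : ℝ) / (M + k) - (1 / (1 + α)) ^ 2 * (α / (1 + α)) ^ r| := by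
    intro a ha
    set w : Fin k → ℝ := fun i => ((a i : ℝ) + 1) / (M + k) with hwdef
    have hw0 : ∀ i, 0 ≤ w i := fun i => by simp only [hwdef]; positivity
    have hw1 : ∑ i, w i = 1 := hw a ha
    set x : Fin k → ℝ := fun i => δ (a i) / √k with hx
    have h1 : (∑ i, ((a i : ℂ) + 1) / (M + k) * F (a + Pi.single i 1)) - F a
        = F a * ((∑ i, (w i : ℂ) * (Complex.exp (x i * Complex.I) - 1 - x i * Complex.I))
          + ((∑ i, w i * x i : ℝ) : ℂ) * Complex.I) := by
      have h2 : ∀ i, F (a + Pi.single i 1) = F a * Complex.exp (x i * Complex.I) := by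
        intro i
        simp only [hF]
        rw [sum_comp_add_single, ← Complex.exp_add]
        congr 1
        simp only [hx, hδ]
        push_cast
        ring
      have h3 : F a = F a * ∑ i, (w i : ℂ) := by
        rw [← Complex.ofReal_sum, hw1, Complex.ofReal_one, mul_one]
      have h4 : ∀ i, ((a i : ℂ) + 1) / (M + k) = (w i : ℂ) := by
        intro i; simp only [hwdef]; push_cast; rfl
      simp only [h2, h4]
      push_cast
      rw [Finset.sum_mul, ← Finset.sum_add_distrib]
      refine (congrArg (_ - ·) h3).trans ?_
      rw [Finset.mul_sum, Finset.mul_sum, ← Finset.sum_sub_distrib]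
      exact Finset.sum_congr rfl fun i _ => by ring
    have hFa : ‖F a‖ = 1 := Complex.norm_exp_ofReal_mul_I _
    rw [h1, norm_mul, hFa, one_mul]
    refine (norm_add_le _ _).trans (add_le_add ?_ ?_)
    · refine (norm_sum_le _ _).trans ?_
      have h5 : ∀ i, ‖(w i : ℂ) * (Complex.exp (x i * Complex.I) - 1 - x i * Complex.I)‖
          ≤ w i * (3 * B ^ 2 * (1 / k)) := by
        intro i
        rw [norm_mul, Complex.norm_real, Real.norm_of_nonneg (hw0 i)]
        refine mul_le_mul_of_nonneg_left ((norm_exp_mul_I_sub_le _).trans ?_) (hw0 i)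
        have h6 : x i ^ 2 = δ (a i) ^ 2 * (1 / k) := by
          simp only [hx]; rw [div_pow, sq √(k : ℝ), hss]; ring
        rw [h6, ← mul_assoc]
        have := sq_le_sq' (abs_le.1 (hδB (a i))).1 (abs_le.1 (hδB (a i))).2
        gcongr
      refine (Finset.sum_le_sum fun i _ => h5 i).trans ?_
      rw [← Finset.sum_mul, hw1, one_mul]
    · rw [norm_mul, Complex.norm_I, mul_one, Complex.norm_real, Real.norm_eq_abs]
      have h7 : ∑ i, w i * x i = (1 / √k) * ∑ i, w i * δ (a i) := by
        rw [Finset.mul_sum]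
        exact Finset.sum_congr rfl fun i _ => by simp only [hx]; ring
      rw [h7, abs_mul, abs_of_nonneg (by positivity)]
      exact mul_le_mul_of_nonneg_left (hdrift a ha) (by positivity)
  have hmain : ‖compCharFun ξ k (M + 1) - compCharFun ξ k M‖
      ≤ 3 * B ^ 2 * (1 / k) + (1 / √k) * ∑ r ∈ Finset.range R, |c r| *
        (C r * (1 / √k + |M - α * k| / k)) := by
    rw [compCharFun, compCharFun, compMean_succ (by omega), ← compMean_sub]
    refine (norm_compMean_le _).trans ((compMean_mono hpoint).trans ?_)
    rw [compMean_add, compMean_const (by omega), compMean_const_mul, compMean_sum]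
    simp only [compMean_const_mul]
    gcongr with r _
    exact hC r k M hk
  refine hmain.trans ?_
  have h8 : (1 / √k) * ∑ r ∈ Finset.range R, |c r| * (C r * (1 / √k + |M - α * k| / k))
      = K * (1 / k + |M - α * k| / (k * √k)) := by
    simp only [← mul_assoc]
    rw [← Finset.sum_mul, ← hK]
    rw [show (1 : ℝ) / k = 1 / √k * (1 / √k) by rw [one_div_mul_one_div, hss]]
    field_simp
  rw [h8, add_mul]
  have h9 : 0 ≤ |M - α * k| / (k * √k) := by positivity
  have : 0 ≤ 3 * B ^ 2 * (|M - α * k| / (k * √k)) := by positivity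
  linarith

/-- Near its centre, the characteristic function hardly depends on the number being composed. -/
lemma exists_norm_compCharFun_sub_le {α : ℝ} (hα : 0 < α) {R : ℕ} {ϑ : ℕ → ℝ}
    (hϑ : ∀ r, R ≤ r → ϑ r = 0) :
    ∃ C : ℝ, 0 ≤ C ∧ ∀ k M m : ℕ, 3 ≤ k → |(m : ℝ) - α * k| ≤ 1 →
      ‖compCharFun (residual α R ϑ) k M - compCharFun (residual α R ϑ) k m‖
        ≤ C / √k * (1 + (M - α * k) ^ 2 / k) := by
  obtain ⟨C, hC0, hC⟩ := exists_norm_compCharFun_succ_sub_le hα hϑ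
  refine ⟨6 * C, by positivity, fun k M m hk hm => ?_⟩
  set g := compCharFun (residual α R ϑ) k with hg
  have hk0 : (3 : ℝ) ≤ k := by exact_mod_cast hk
  have hkp : (0 : ℝ) < k := by linarith
  have hs : 0 < √(k : ℝ) := Real.sqrt_pos.2 hkp
  have hss : √(k : ℝ) * √(k : ℝ) = k := Real.mul_self_sqrt hkp.le
  set y := |(M : ℝ) - α * k| + 1 with hy
  have hy1 : 1 ≤ y := by have := abs_nonneg ((M : ℝ) - α * k); linarith
  -- both endpoints, hence all intermediate totals, are within `y` of the centre
  have hstep : ∀ (a d : ℕ), (∀ j ≤ d, |((a + j : ℕ) : ℝ) - α * k| ≤ y) →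
      ‖g (a + d) - g a‖ ≤ d * (C * (1 / k + y / (k * √k))) := by
    intro a d
    induction d with
    | zero => simp
    | succ d ih =>
      intro h
      have h1 := ih fun j hj => h j (by omega)
      have h2 := hC k (a + d) hk
      have h3 := h d (by omega)
      have h4 : C * (1 / k + |((a + d : ℕ) : ℝ) - α * k| / (k * √k))
          ≤ C * (1 / k + y / (k * √k)) := by gcongr
      have h5 := norm_sub_le_norm_sub_add_norm_sub (g (a + d + 1)) (g (a + d)) (g a)
      rw [← add_assoc]
      push_cast
      linarith
  have hbase : ‖g M - g m‖ ≤ y * (C * (1 / k + y / (k * √k))) := by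
    have hc0 : 0 ≤ C * (1 / k + y / (k * √k)) := by positivity
    have hM := abs_le.1 (le_refl |(M : ℝ) - α * k|)
    have hm' := abs_le.1 hm
    rcases le_total m M with h | h
    · obtain ⟨d, rfl⟩ := Nat.exists_eq_add_of_le h
      refine (hstep m d ?_).trans (mul_le_mul_of_nonneg_right ?_ hc0)
      · intro j hj
        have : (j : ℝ) ≤ d := by exact_mod_cast hj
        have hj0 : (0 : ℝ) ≤ j := by positivity
        push_cast at hM hy ⊢
        rw [abs_le]
        constructor <;> linarith
      · push_cast at hM hy
        linarith
    · obtain ⟨d, rfl⟩ := Nat.exists_eq_add_of_le h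
      rw [norm_sub_rev]
      refine (hstep M d ?_).trans (mul_le_mul_of_nonneg_right ?_ hc0)
      · intro j hj
        have : (j : ℝ) ≤ d := by exact_mod_cast hj
        have hj0 : (0 : ℝ) ≤ j := by positivity
        push_cast at hm' ⊢
        rw [abs_le]
        constructor <;> linarith
      · push_cast at hm'
        linarith
  refine hbase.trans ?_
  have hsq : (M - α * k) ^ 2 = (y - 1) ^ 2 := by rw [← sq_abs, hy]; ring
  rw [hsq]
  have e1 : y * (C * (1 / k + y / (k * √k))) = C / √k * (y * √k + y ^ 2) / k := by
    field_simp
  have e2 : 6 * C / √k * (1 + (y - 1) ^ 2 / k) = C / √k * (6 * k + 6 * (y - 1) ^ 2) / k := by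
    field_simp
  rw [e1, e2]
  have h0 : 0 ≤ C / √k := by positivity
  refine div_le_div_of_nonneg_right (mul_le_mul_of_nonneg_left ?_ h0) hkp.le
  nlinarith [sq_nonneg (y - √k), sq_nonneg (3 * y - 4)]

/-! ### Independent geometric variables -/

lemma hasSum_of_eq {E : Type*} [AddCommMonoid E] [TopologicalSpace E] {f g : ℕ → E} {a b : E}
    (h : HasSum f a) (hfg : ∀ n, g n = f n) (hab : b = a) : HasSum g b := by
  rwa [hab, funext hfg]

/-- Powers of an absolutely convergent series, as sums over compositions. -/
lemma hasSum_sum_prod_compositions {𝕜 : Type*} [RCLike 𝕜] {f : ℕ → 𝕜}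
    (hf : Summable fun r => ‖f r‖) (k : ℕ) :
    HasSum (fun M => ∑ a ∈ antidiagonalTuple k M, ∏ i, f (a i)) ((∑' r, f r) ^ k) := by
  obtain ⟨c, hc⟩ : ∃ c : ℕ → ℕ → 𝕜, ∀ k M,
      c k M = ∑ a ∈ antidiagonalTuple k M, ∏ i, f (a i) := ⟨_, fun _ _ => rfl⟩
  have hc00 : c 0 0 = 1 := by simp [hc]
  have hc0 : ∀ M, M ≠ 0 → c 0 M = 0 := by
    intro M hM
    obtain ⟨M, rfl⟩ := Nat.exists_eq_succ_of_ne_zero hM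
    simp [hc]
  have hcs : ∀ k M, c (k + 1) M = ∑ r ∈ Finset.range (M + 1), f r * c k (M - r) := by
    intro k M
    rw [hc, sum_antidiagonalTuple_succ 0]
    refine Finset.sum_congr rfl fun r _ => ?_
    rw [hc, Finset.mul_sum]
    refine Finset.sum_congr rfl fun a _ => ?_
    simp [Fin.prod_univ_succ]
  have key : (Summable fun M => ‖c k M‖) ∧ ∑' M, c k M = (∑' r, f r) ^ k := by
    clear hc
    induction k with
    | zero =>
      constructor
      · refine summable_of_ne_finset_zero (s := {0}) fun M hM => ?_
        rw [hc0 M (by simpa using hM), norm_zero]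
      · rw [tsum_eq_single 0 hc0, hc00, pow_zero]
    | succ k ih =>
      simp only [hcs]
      refine ⟨summable_norm_sum_mul_range_of_summable_norm hf ih.1, ?_⟩
      rw [← tsum_mul_tsum_eq_tsum_sum_range_of_summable_norm hf ih.1, ih.2, pow_succ']
  simp only [← hc]
  rw [← key.2]
  exact key.1.of_norm.hasSum

lemma hasSum_numComp_mul_pow (k : ℕ) {q : ℝ} (hq0 : 0 ≤ q) (hq1 : q < 1) :
    HasSum (fun M => (numComp k M : ℝ) * q ^ M) (((1 - q)⁻¹) ^ k) := by
  have h := hasSum_sum_prod_compositions (f := fun r => q ^ r) (𝕜 := ℝ)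
    (by simpa [abs_of_nonneg hq0] using summable_geometric_of_lt_one hq0 hq1) k
  rw [tsum_geometric_of_lt_one hq0 hq1] at h
  refine hasSum_of_eq h (fun M => ?_) rfl
  rw [numComp, ← nsmul_eq_mul, ← Finset.sum_const]
  refine Finset.sum_congr rfl fun a ha => ?_
  rw [Finset.prod_pow_eq_pow_sum, Finset.Nat.mem_antidiagonalTuple.1 ha]

lemma succ_mul_numComp_succ (k M : ℕ) :
    ((M : ℝ) + 1) * numComp k (M + 1) = k * numComp (k + 1) M := by
  have h1 := numComp_succ k M
  have h2 := mul_numComp_succ k M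
  exact_mod_cast h1.trans h2.symm

lemma hasSum_mul_numComp_mul_pow (k : ℕ) {q : ℝ} (hq0 : 0 ≤ q) (hq1 : q < 1) :
    HasSum (fun M : ℕ => (M : ℝ) * (numComp k M * q ^ M)) (k * q * ((1 - q)⁻¹) ^ (k + 1)) := by
  rw [← hasSum_nat_add_iff' 1]
  simp only [Finset.range_one, Finset.sum_singleton, Nat.cast_zero, zero_mul, sub_zero]
  refine hasSum_of_eq ((hasSum_numComp_mul_pow (k + 1) hq0 hq1).mul_left (k * q)) (fun M => ?_)
    (by ring)
  push_cast
  rw [← mul_assoc, succ_mul_numComp_succ, pow_succ]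
  ring

lemma hasSum_sq_mul_numComp_mul_pow (k : ℕ) {q : ℝ} (hq0 : 0 ≤ q) (hq1 : q < 1) :
    HasSum (fun M : ℕ => (M : ℝ) ^ 2 * (numComp k M * q ^ M))
      (k * q * ((k + 1) * q * ((1 - q)⁻¹) ^ (k + 2) + ((1 - q)⁻¹) ^ (k + 1))) := by
  rw [← hasSum_nat_add_iff' 1]
  simp only [Finset.range_one, Finset.sum_singleton, Nat.cast_zero, zero_mul, sub_zero, ne_eq,
    OfNat.ofNat_ne_zero, not_false_eq_true, zero_pow]
  refine hasSum_of_eq (((hasSum_mul_numComp_mul_pow (k + 1) hq0 hq1).add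
    (hasSum_numComp_mul_pow (k + 1) hq0 hq1)).mul_left (k * q)) (fun M => ?_) ?_
  · have := succ_mul_numComp_succ k M
    push_cast
    rw [pow_succ q]
    linear_combination (((M : ℝ) + 1) * q ^ M * q) * this
  · push_cast; ring

/-- The probability that `k` independent geometric variables of mean `α` have sum `M`; for `k = 1`
it is the geometric weight itself. -/
noncomputable def negBinWeight (α : ℝ) (k M : ℕ) : ℝ :=
  (1 / (1 + α)) ^ k * (numComp k M * (α / (1 + α)) ^ M)

section
variable {α : ℝ} (hα : 0 < α)
include hα

lemma ratio_mem : 0 ≤ α / (1 + α) ∧ α / (1 + α) < 1 :=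
  ⟨by positivity, by rw [div_lt_one (by positivity)]; linarith⟩

lemma inv_one_sub_ratio : (1 - α / (1 + α))⁻¹ = 1 + α := by
  have : 1 - α / (1 + α) = 1 / (1 + α) := by field_simp; ring
  rw [this, one_div, inv_inv]

lemma hasSum_negBinWeight (k : ℕ) : HasSum (negBinWeight α k) 1 := by
  have h := (hasSum_numComp_mul_pow k (ratio_mem hα).1 (ratio_mem hα).2).mul_left
    ((1 / (1 + α)) ^ k)
  rw [inv_one_sub_ratio hα, ← mul_pow] at h
  refine hasSum_of_eq h (fun M => rfl) ?_
  rw [one_div, inv_mul_cancel₀ (by positivity), one_pow]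

lemma hasSum_negBinWeight_mul_sub (k : ℕ) :
    HasSum (fun M => negBinWeight α k M * (M - α * k)) 0 := by
  have h1 := (hasSum_mul_numComp_mul_pow k (ratio_mem hα).1 (ratio_mem hα).2).mul_left
    ((1 / (1 + α)) ^ k)
  have h0 := (hasSum_negBinWeight hα k).mul_left (α * k)
  rw [inv_one_sub_ratio hα] at h1
  refine hasSum_of_eq (h1.sub h0) (fun M => ?_) ?_
  · rw [negBinWeight]; ring
  · rw [div_pow, one_pow]
    field_simp
    ring

lemma hasSum_negBinWeight_mul_sq (k : ℕ) :
    HasSum (fun M => negBinWeight α k M * (M - α * k) ^ 2) (k * (α * (1 + α))) := by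
  have h2 := (hasSum_sq_mul_numComp_mul_pow k (ratio_mem hα).1 (ratio_mem hα).2).mul_left
    ((1 / (1 + α)) ^ k)
  have h1 := (hasSum_negBinWeight_mul_sub hα k).mul_left (2 * α * k)
  have h0 := (hasSum_negBinWeight hα k).mul_left ((α * k) ^ 2)
  rw [inv_one_sub_ratio hα] at h2
  refine hasSum_of_eq ((h2.sub h1).sub h0) (fun M => ?_) ?_
  · rw [negBinWeight]; ring
  · rw [div_pow, one_pow]
    field_simp
    ring

lemma negBinWeight_nonneg (k M : ℕ) : 0 ≤ negBinWeight α k M := by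
  unfold negBinWeight; positivity

omit hα in
lemma negBinWeight_one (M : ℕ) : negBinWeight α 1 M = 1 / (1 + α) * (α / (1 + α)) ^ M := by
  have : numComp 1 M = 1 := by simp [numComp]
  simp [negBinWeight, this]

/-- A composition of a negative binomial number `M` into `k` parts is a family of `k` independent
geometric variables, so the mixture of the characteristic functions is a `k`-th power. -/
lemma hasSum_negBinWeight_mul_compCharFun (ξ : ℕ → ℝ) {k : ℕ} (hk : k ≠ 0) :
    HasSum (fun M => (negBinWeight α k M : ℂ) * compCharFun ξ k M)
      ((∑' r, (negBinWeight α 1 r : ℂ) * Complex.exp ((ξ r / √k : ℝ) * Complex.I)) ^ k) := by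
  have hs : Summable fun r =>
      ‖(negBinWeight α 1 r : ℂ) * Complex.exp ((ξ r / √k : ℝ) * Complex.I)‖ := by
    refine (hasSum_negBinWeight hα 1).summable.congr fun r => ?_
    rw [norm_mul, Complex.norm_exp_ofReal_mul_I, mul_one, Complex.norm_real,
      Real.norm_of_nonneg (negBinWeight_nonneg hα 1 r)]
  refine hasSum_of_eq (hasSum_sum_prod_compositions hs k) (fun M => ?_) rfl
  obtain ⟨k, rfl⟩ := Nat.exists_eq_succ_of_ne_zero hk
  have hn := numComp_ne_zero (𝕜 := ℂ) k M
  rw [compCharFun, compMean, negBinWeight]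
  push_cast
  rw [show ∀ x y z s : ℂ, x * (y * z) * (s / y) = x * z * s * (y / y) by intros; ring,
    div_self hn, mul_one, Finset.mul_sum]
  refine Finset.sum_congr rfl fun a ha => ?_
  rw [Finset.prod_mul_distrib, ← Complex.exp_sum]
  congr 1
  · simp only [negBinWeight_one]
    push_cast
    rw [Finset.prod_mul_distrib, Finset.prod_pow_eq_pow_sum,
      Finset.Nat.mem_antidiagonalTuple.1 ha]
    simp
  · congr 1
    rw [Finset.sum_div, Finset.sum_mul]

end

/-! ### The central limit theorem for compositions -/

/-- Summation by parts identifies the slope as the covariance of `ϑ X` and `X` over the variance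
of `X`, where `X` has the geometric law of mean `α`. -/
lemma slope_mul {α : ℝ} (hα : 0 < α) (ϑ : ℕ → ℝ) (R : ℕ) :
    slope α R ϑ * (α * (1 + α))
      = ∑ r ∈ Finset.range R, ϑ r * (1 / (1 + α) * (α / (1 + α)) ^ r) * (r - α)
        + ϑ R * (R * (α / (1 + α)) ^ R) := by
  unfold slope
  induction R with
  | zero => simp
  | succ R ih =>
    rw [Finset.sum_range_succ, add_mul, ih, Finset.sum_range_succ,
      pow_succ (α / (1 + α)), add_assoc, add_assoc]
    congr 1
    push_cast
    generalize (α / (1 + α)) ^ R = t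
    field_simp
    ring

/-- The variance of the residual of `ϑ X`, by Pythagoras. -/
noncomputable def residualVar (α : ℝ) (R : ℕ) (ϑ : ℕ → ℝ) : ℝ :=
  ∑ r ∈ Finset.range R, ϑ r ^ 2 * negBinWeight α 1 r
    - (∑ r ∈ Finset.range R, ϑ r * negBinWeight α 1 r) ^ 2
    - (∑ r ∈ Finset.range R, ϑ r * negBinWeight α 1 r * (r - α)) ^ 2 / (α * (1 + α))

section
variable {α : ℝ} (hα : 0 < α) {R : ℕ} {ϑ : ℕ → ℝ} (hϑ : ∀ r, R ≤ r → ϑ r = 0)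
include hα hϑ

lemma hasSum_residual : HasSum (fun r => negBinWeight α 1 r * residual α R ϑ r) 0 := by
  have h1 : HasSum (fun r => ϑ r * negBinWeight α 1 r)
      (∑ r ∈ Finset.range R, ϑ r * negBinWeight α 1 r) :=
    hasSum_sum_of_ne_finset_zero fun r hr => by
      rw [hϑ r (by simpa using hr), zero_mul]
  have h2 := (hasSum_negBinWeight hα 1).mul_left (∑ r ∈ Finset.range R, ϑ r * negBinWeight α 1 r)
  have h3 := (hasSum_negBinWeight_mul_sub hα 1).mul_left (slope α R ϑ)
  refine hasSum_of_eq ((h1.sub h2).sub h3) (fun r => ?_) (by ring)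
  simp only [residual, negBinWeight_one]
  push_cast
  ring

lemma hasSum_residual_sq :
    HasSum (fun r => negBinWeight α 1 r * residual α R ϑ r ^ 2) (residualVar α R ϑ) := by
  set μ := ∑ r ∈ Finset.range R, ϑ r * negBinWeight α 1 r with hμ
  set b := slope α R ϑ with hb
  have hbc : b * (α * (1 + α))
      = ∑ r ∈ Finset.range R, ϑ r * negBinWeight α 1 r * (r - α) := by
    rw [hb, slope_mul hα, hϑ R le_rfl, zero_mul, add_zero]
    simp only [negBinWeight_one]
  have h1 : HasSum (fun r => (ϑ r ^ 2 - 2 * μ * ϑ r - 2 * b * (ϑ r * (r - α)))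
      * negBinWeight α 1 r) (∑ r ∈ Finset.range R,
        (ϑ r ^ 2 - 2 * μ * ϑ r - 2 * b * (ϑ r * (r - α))) * negBinWeight α 1 r) :=
    hasSum_sum_of_ne_finset_zero fun r hr => by
      rw [hϑ r (by simpa using hr)]; simp
  have h2 := (hasSum_negBinWeight hα 1).mul_left (μ ^ 2)
  have h3 := (hasSum_negBinWeight_mul_sub hα 1).mul_left (2 * b * μ)
  have h4 := (hasSum_negBinWeight_mul_sq hα 1).mul_left (b ^ 2)
  refine hasSum_of_eq (((h1.add h2).add h3).add h4) (fun r => ?_) ?_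
  · have : residual α R ϑ r = ϑ r - μ - b * (r - α) := by
      simp only [residual, hμ, negBinWeight_one, hb]
    rw [this]
    push_cast
    ring
  · have h5 : ∑ r ∈ Finset.range R,
        (ϑ r ^ 2 - 2 * μ * ϑ r - 2 * b * (ϑ r * (r - α))) * negBinWeight α 1 r
        = ∑ r ∈ Finset.range R, ϑ r ^ 2 * negBinWeight α 1 r - 2 * μ * μ
          - 2 * b * (b * (α * (1 + α))) := by
      have h6 : 2 * μ * μ = ∑ r ∈ Finset.range R, 2 * μ * (ϑ r * negBinWeight α 1 r) := by
        rw [← Finset.mul_sum]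
      have h7 : 2 * b * ∑ r ∈ Finset.range R, ϑ r * negBinWeight α 1 r * (r - α)
          = ∑ r ∈ Finset.range R, 2 * b * (ϑ r * negBinWeight α 1 r * (r - α)) := by
        rw [Finset.mul_sum]
      rw [hbc, h6, h7, ← Finset.sum_sub_distrib, ← Finset.sum_sub_distrib]
      exact Finset.sum_congr rfl fun r _ => by ring
    rw [h5, residualVar, ← hμ, ← hbc]
    have : α * (1 + α) ≠ 0 := by positivity
    push_cast
    field_simp
    ring

lemma residualVar_nonneg : 0 ≤ residualVar α R ϑ :=
  (hasSum_residual_sq hα hϑ).nonneg fun r => mul_nonneg (negBinWeight_nonneg hα 1 r) (sq_nonneg _)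

end

/-- The success probability of the geometric law of mean `α`. -/
noncomputable def geomParam {α : ℝ} (hα : 0 < α) : unitInterval :=
  ⟨1 / (1 + α), by positivity, by rw [div_le_one (by positivity)]; linarith⟩

lemma integral_geomParam {α : ℝ} (hα : 0 < α) {E : Type*} [NormedAddCommGroup E] [NormedSpace ℝ E]
    [FiniteDimensional ℝ E] (f : ℕ → E) :
    ∫ r, f r ∂geometricMeasure (geomParam hα) = ∑' r, negBinWeight α 1 r • f r := by
  have h0 : geomParam hα ≠ 0 := by
    intro h
    have : (1 : ℝ) / (1 + α) = 0 := congrArg Subtype.val h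
    have : (0 : ℝ) < 1 / (1 + α) := by positivity
    linarith
  rw [integral_geometricMeasure h0]
  refine tsum_congr fun r => ?_
  congr 1
  rw [negBinWeight_one]
  have h1 : ((geomParam hα : unitInterval) : ℝ) = 1 / (1 + α) := rfl
  have h2 : 1 - 1 / (1 + α) = α / (1 + α) := by field_simp; ring
  rw [h1, h2, mul_comm]

/-- The central limit theorem for independent geometric variables, in terms of series. -/
lemma tendsto_geometric_charFun_pow {α : ℝ} (hα : 0 < α) {ξ : ℕ → ℝ} {v : ℝ}
    (h0 : HasSum (fun r => negBinWeight α 1 r * ξ r) 0)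
    (h1 : HasSum (fun r => negBinWeight α 1 r * ξ r ^ 2) v) :
    Tendsto (fun k : ℕ =>
      (∑' r, (negBinWeight α 1 r : ℂ) * Complex.exp ((ξ r / √k : ℝ) * Complex.I)) ^ k) atTop
      (𝓝 (Complex.exp (-(v : ℂ) / 2))) := by
  have hnn : ∀ r, 0 ≤ negBinWeight α 1 r * ξ r ^ 2 := fun r =>
    mul_nonneg (negBinWeight_nonneg hα 1 r) (sq_nonneg _)
  have hpos : ∀ r, 0 < negBinWeight α 1 r := fun r => by rw [negBinWeight_one]; positivity
  have hv : 0 ≤ v := h1.nonneg hnn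
  -- a vanishing variance forces `ξ = 0`; otherwise `ξ` is normalized to unit variance
  rcases hv.eq_or_lt with hv | hv
  · have hξ : ∀ r, ξ r = 0 := by
      intro r
      rw [← hv, hasSum_zero_iff_of_nonneg hnn] at h1
      have := congrFun h1 r
      simpa [(hpos r).ne'] using this
    have h2 : ∑' r, (negBinWeight α 1 r : ℂ) = 1 := by
      rw [← Complex.ofReal_tsum, (hasSum_negBinWeight hα 1).tsum_eq, Complex.ofReal_one]
    simp [hξ, h2, ← hv]
  · set σ := √v with hσ
    have hσ0 : 0 < σ := Real.sqrt_pos.2 hv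
    have hσ2 : σ ^ 2 = v := Real.sq_sqrt hv.le
    set X : ℕ → ℝ := fun r => ξ r / σ with hX
    have hmean : (geometricMeasure (geomParam hα))[X] = 0 := by
      rw [integral_geomParam hα]
      have := h0.div_const σ
      rw [zero_div] at this
      rw [← this.tsum_eq]
      exact tsum_congr fun r => by simp only [hX, smul_eq_mul]; ring
    have hvar : (geometricMeasure (geomParam hα))[X ^ 2] = 1 := by
      rw [integral_geomParam hα]
      have := h1.div_const (σ ^ 2)
      rw [hσ2, div_self hv.ne'] at this
      rw [← this.tsum_eq]
      exact tsum_congr fun r => by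
        simp only [hX, smul_eq_mul, Pi.pow_apply, div_pow, hσ2]; ring
    have h := tendsto_charFun_inv_sqrt_mul_pow (P := geometricMeasure (geomParam hα)) (X := X)
      (Measurable.of_discrete.aemeasurable) hmean hvar σ
    have he : Complex.exp (-(σ : ℂ) ^ 2 / 2) = Complex.exp (-(v : ℂ) / 2) := by
      rw [← Complex.ofReal_pow, hσ2]
    rw [he] at h
    refine h.congr fun k => ?_
    congr 1
    rw [charFun_apply_real, integral_map Measurable.of_discrete.aemeasurable
      (by fun_prop), integral_geomParam hα]
    refine tsum_congr fun r => ?_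
    rw [Complex.real_smul]
    congr 2
    rw [← Complex.ofReal_mul]
    congr 2
    simp only [hX]
    field_simp

/-- The central limit theorem for uniform compositions. The mixture of the compositions over a
negative binomial number of units is an independent family, and the residuals are insensitive to
that number. -/
lemma tendsto_compCharFun {α : ℝ} (hα : 0 < α) {R : ℕ} {ϑ : ℕ → ℝ}
    (hϑ : ∀ r, R ≤ r → ϑ r = 0) :
    Tendsto (fun k : ℕ => compCharFun (residual α R ϑ) k ⌊α * (k : ℝ)⌋₊) atTop
      (𝓝 (Complex.exp (-(residualVar α R ϑ : ℂ) / 2))) := by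
  have hclt := tendsto_geometric_charFun_pow hα (hasSum_residual hα hϑ) (hasSum_residual_sq hα hϑ)
  obtain ⟨C, hC0, hC⟩ := exists_norm_compCharFun_sub_le hα hϑ
  set ξ := residual α R ϑ
  refine hclt.congr_dist ?_
  have hlim : Tendsto (fun k : ℕ => C * (1 + α * (1 + α)) * (√(k : ℝ))⁻¹) atTop (𝓝 0) := by
    rw [← mul_zero (C * (1 + α * (1 + α)))]
    exact (tendsto_inv_atTop_zero.comp
      (Real.tendsto_sqrt_atTop.comp tendsto_natCast_atTop_atTop)).const_mul _
  refine squeeze_zero' (Eventually.of_forall fun _ => dist_nonneg) ?_ hlim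
  filter_upwards [eventually_ge_atTop 3] with k hk
  have hkp : (0 : ℝ) < k := by
    have : 0 < k := by omega
    exact_mod_cast this
  set m := ⌊α * (k : ℝ)⌋₊ with hm
  have hmk : |(m : ℝ) - α * k| ≤ 1 := by
    have h1 := Nat.floor_le (by positivity : 0 ≤ α * (k : ℝ))
    have h2 := Nat.lt_floor_add_one (α * (k : ℝ))
    rw [abs_le]
    constructor <;> linarith
  -- subtract the value at the floor under the mixture; the mean square deviation of the negative
  -- binomial law is `k * α * (1 + α)`, which makes the averaged bound `O(1 / √k)`
  have h1 := hasSum_negBinWeight_mul_compCharFun hα ξ (k := k) (by omega)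
  have h2 : HasSum (fun M => (negBinWeight α k M : ℂ) * compCharFun ξ k m)
      (1 * compCharFun ξ k m) := by
    refine HasSum.mul_right _ ?_
    have h := Complex.hasSum_ofReal.2 (hasSum_negBinWeight hα k)
    rwa [Complex.ofReal_one] at h
  have h3 := h1.sub h2
  rw [one_mul] at h3
  rw [dist_eq_norm]
  have h4 : HasSum (fun M => negBinWeight α k M * (C / √k * (1 + (M - α * k) ^ 2 / k)))
      (C / √k * (1 + α * (1 + α))) := by
    refine hasSum_of_eq (((hasSum_negBinWeight hα k).add
      ((hasSum_negBinWeight_mul_sq hα k).div_const (k : ℝ))).mul_left (C / √k)) (fun M => ?_) ?_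
    · ring
    · field_simp
  refine (h3.norm_le_of_bounded h4 fun M => ?_).trans_eq (by ring)
  rw [← mul_sub, norm_mul, Complex.norm_real, Real.norm_of_nonneg (negBinWeight_nonneg hα k M)]
  exact mul_le_mul_of_nonneg_left (hC k M m hk hmk) (negBinWeight_nonneg hα k M)

/-! ### From compositions to graphs -/

lemma degree_eq_vdeg {N : ℕ} (G : SimpleGraph (Fin N)) (v : Fin N) [Fintype (G.neighborSet v)] :
    G.degree v = vdeg G v := by
  classical
  rw [vdeg, ← Finset.card_filter, ← SimpleGraph.card_neighborFinset_eq_degree]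
  congr 1
  ext w
  simp

lemma mem_graphs_iff (n₁ n₂ : ℕ) (G : SimpleGraph (Fin (n₁ + n₂))) :
    G ∈ graphs n₁ n₂ ↔ IsMem n₁ G := by
  classical
  have hsum : (∀ u, 1 ≤ vdeg G u ∧ vdeg G u ≤ 2) → ∑ u, (2 - vdeg G u)
      = (Finset.univ.filter fun u => vdeg G u = 1).card := by
    intro h
    rw [Finset.card_filter]
    refine Finset.sum_congr rfl fun u _ => ?_
    have := h u
    split_ifs <;> omega
  have hadd : (Finset.univ.filter fun u => vdeg G u = 1 ∨ vdeg G u = 2).card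
      = (Finset.univ.filter fun u => vdeg G u = 1).card
        + (Finset.univ.filter fun u => vdeg G u = 2).card := by
    rw [Finset.filter_or, Finset.card_union_of_disjoint]
    rw [Finset.disjoint_filter]
    intro u _ h
    omega
  simp only [graphs, Set.mem_ofPred_eq, degree_eq_vdeg, IsMem]
  constructor
  · rintro ⟨h1, h2⟩
    have h : ∀ u, 1 ≤ vdeg G u ∧ vdeg G u ≤ 2 := by
      have hu : (Finset.univ.filter fun u => vdeg G u = 1 ∨ vdeg G u = 2) = Finset.univ := by
        rw [← Finset.card_eq_iff_eq_univ, hadd, h1, h2, Fintype.card_fin]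
      intro u
      have := Finset.filter_eq_self.1 hu u (Finset.mem_univ u)
      omega
    exact ⟨h, (hsum h).trans h1⟩
  · rintro ⟨h, h1⟩
    rw [hsum h] at h1
    refine ⟨h1, ?_⟩
    have hu : (Finset.univ.filter fun u => vdeg G u = 1 ∨ vdeg G u = 2) = Finset.univ :=
      Finset.filter_eq_self.2 fun u _ => by have := h u; omega
    rw [hu, h1, Finset.card_univ, Fintype.card_fin] at hadd
    omega

lemma integral_uniformGraph {𝕜 : Type*} [RCLike 𝕜] (n₁ n₂ : ℕ) (F : (ℕ → ℕ) → 𝕜) :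
    ∫ G, F (compCount G) ∂(uniformGraph n₁ n₂)
      = memSum (n₁ + n₂) n₁ F / memSum (n₁ + n₂) n₁ (fun _ => (1 : 𝕜)) := by
  classical
  have hset : graphs n₁ n₂ = ((Finset.univ.filter fun G => IsMem n₁ G :
      Finset (SimpleGraph (Fin (n₁ + n₂)))) : Set (SimpleGraph (Fin (n₁ + n₂)))) := by
    ext G
    simp [mem_graphs_iff]
  rw [uniformGraph, uniformOn, ProbabilityTheory.cond, integral_smul_measure, hset,
    setIntegral_finset, Measure.count_apply_finset]
  · simp only [Measure.real, Measure.count_singleton, ENNReal.toReal_one, one_smul,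
      ENNReal.toReal_inv, ENNReal.toReal_natCast]
    rw [memSum, memSum, ← Finset.sum_filter, ← Finset.sum_filter, Finset.sum_const, nsmul_eq_mul,
      mul_one, RCLike.real_smul_eq_coe_mul, div_eq_inv_mul]
    push_cast
    rfl
  · exact Integrable.of_finite.integrableOn

lemma memSum_sub_const {𝕜 : Type*} [Field 𝕜] (N D : ℕ) (F : (ℕ → ℕ) → 𝕜) (x : 𝕜) :
    memSum N D (fun u => F u - x) = memSum N D F - x * memSum N D (fun _ => 1) := by
  simp only [memSum, Finset.mul_sum, ← Finset.sum_sub_distrib]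
  refine Finset.sum_congr rfl fun G _ => ?_
  split_ifs <;> simp

lemma ofReal_memSum_one {𝕜 : Type*} [RCLike 𝕜] (N D : ℕ) :
    ((memSum N D (fun _ => (1 : ℝ)) : ℝ) : 𝕜) = memSum N D (fun _ => (1 : 𝕜)) := by
  simp only [memSum]
  push_cast
  refine Finset.sum_congr rfl fun G _ => ?_
  split_ifs <;> simp

/-- Reserving `l` units for the cycles makes the compositions exponentially fewer. -/
lemma numComp_sub_le {α : ℝ} (hα : 0 < α) {k : ℕ} (hk : 2 ≤ k) {m : ℕ} (hm : (m : ℝ) ≤ α * k)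
    {l : ℕ} (hl : l ≤ m) :
    (numComp k (m - l) : ℝ) ≤ (2 * α / (2 * α + 1)) ^ l * numComp k m := by
  have hk2 : (2 : ℝ) ≤ k := by exact_mod_cast hk
  induction l with
  | zero => simp
  | succ l ih =>
    obtain ⟨M, hM⟩ : ∃ M, m - l = M + 1 := ⟨m - l - 1, by omega⟩
    have hM' : m - (l + 1) = M := by omega
    have h1 := ih (by omega)
    rw [hM] at h1
    rw [hM', pow_succ]
    have h2 : ((M : ℝ) + 1) * numComp k (M + 1) = (M + k) * numComp k M := by
      exact_mod_cast numComp_succ k M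
    have hMm : (M : ℝ) + 1 ≤ α * k := by
      have : ((M + 1 : ℕ) : ℝ) ≤ m := by exact_mod_cast (by omega : M + 1 ≤ m)
      push_cast at this
      linarith
    have hMk : (0 : ℝ) < M + k := by positivity
    have h3 : (numComp k M : ℝ) = (M + 1) / (M + k) * numComp k (M + 1) := by
      field_simp; linarith
    -- `M + 1 ≤ α * k ≤ 2 * α * (k - 1)`, and `M + k = (M + 1) + (k - 1)`
    have h4 : ((M : ℝ) + 1) / (M + k) ≤ 2 * α / (2 * α + 1) := by
      rw [div_le_div_iff₀ hMk (by positivity)]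
      nlinarith
    calc (numComp k M : ℝ) = (M + 1) / (M + k) * numComp k (M + 1) := h3
      _ ≤ 2 * α / (2 * α + 1) * ((2 * α / (2 * α + 1)) ^ l * numComp k m) := by gcongr
      _ = _ := by ring

lemma summable_sq_mul_pow {α : ℝ} (hα : 0 < α) :
    Summable fun l : ℕ => (1 + (l : ℝ)) ^ 2 * (2 * α / (2 * α + 1)) ^ l := by
  have hr : ‖2 * α / (2 * α + 1)‖ < 1 := by
    rw [Real.norm_of_nonneg (by positivity), div_lt_one (by positivity)]
    linarith
  have h0 := summable_pow_mul_geometric_of_norm_lt_one 0 hr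
  have h1 := summable_pow_mul_geometric_of_norm_lt_one 1 hr
  have h2 := summable_pow_mul_geometric_of_norm_lt_one 2 hr
  refine ((h0.add (h1.mul_left 2)).add h2).congr fun l => ?_
  ring

/-- The moment of the number of vertices on cycles that controls the error of ignoring them. -/
noncomputable def cycleMoment (α : ℝ) : ℝ :=
  ∑' l : ℕ, (1 + (l : ℝ)) ^ 2 * (2 * α / (2 * α + 1)) ^ l

lemma cycleMoment_nonneg {α : ℝ} (hα : 0 < α) : 0 ≤ cycleMoment α :=
  tsum_nonneg fun l => by positivity

/-- The comparison of random graphs with uniform compositions. If the number `l` of vertices on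
cycles shifts the mean of `F` over compositions from `x` by at most `B * (1 + l) ^ 2`, then the
mean of `F` over the graphs is `x` up to a multiple of `B`. -/
lemma norm_integral_uniformGraph_sub_le {𝕜 : Type*} [RCLike 𝕜] {α : ℝ} (hα : 0 < α) {k : ℕ}
    (hk : 2 ≤ k) {m : ℕ} (hm : (m : ℝ) ≤ α * k) (F : (ℕ → ℕ) → 𝕜) (x : 𝕜) {B : ℝ} (hB : 0 ≤ B)
    (h : ∀ l ≤ m, ∀ G : SimpleGraph (Fin l),
      ‖compMean k (m - l) (fun a => F (compCount G + pathCount a)) - x‖ ≤ B * (1 + l) ^ 2) :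
    ‖∫ G, F (compCount G) ∂(uniformGraph (2 * k) m) - x‖ ≤ B * cycleMoment α := by
  classical
  obtain ⟨k', hk'⟩ : ∃ k', k = k' + 1 := ⟨k - 1, by omega⟩
  set c : ℝ := (2 ^ k * k.factorial : ℕ) / ((2 * k + m).factorial : ℝ) with hc
  have hc0 : 0 < c := by positivity
  have hn : (0 : ℝ) < numComp k m := by
    rw [hk']; exact_mod_cast numComp_pos k' m
  -- the total mass is at least that of the graphs without cycles
  have hZ : (numComp k m : ℝ) ≤ c * memSum (2 * k + m) (2 * k) (fun _ => (1 : ℝ)) := by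
    have h1 := memSum_eq_sum_compositions (𝕜 := ℝ) k m (fun _ => 1)
    have h2 : c * memSum (2 * k + m) (2 * k) (fun _ => (1 : ℝ))
        = ∑ l ∈ Finset.range (m + 1), ∑ a ∈ antidiagonalTuple k (m - l),
          memSum l 0 (fun _ => (1 : ℝ)) / (l.factorial : ℝ) := by
      rw [← h1, hc]; ring
    rw [h2]
    have h3 := Finset.single_le_sum (f := fun l => ∑ a ∈ antidiagonalTuple k (m - l),
          memSum l 0 (fun _ => (1 : ℝ)) / (l.factorial : ℝ)) (s := Finset.range (m + 1))
      (fun l _ => Finset.sum_nonneg fun a _ => div_nonneg (memSum_zero_nonneg l 0) (by positivity))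
      (Finset.mem_range.2 (Nat.succ_pos m))
    refine le_trans (le_of_eq ?_) h3
    simp [memSum_zero_zero, numComp]
  -- each `l` contributes at most `B * (1 + l) ^ 2` times a geometric weight
  have hS : c * ‖memSum (2 * k + m) (2 * k) (fun u => F u - x)‖
      ≤ numComp k m * (B * cycleMoment α) := by
    have h1 := memSum_eq_sum_compositions (𝕜 := 𝕜) k m (fun u => F u - x)
    have h2 : c * ‖memSum (2 * k + m) (2 * k) (fun u => F u - x)‖
        = ‖∑ l ∈ Finset.range (m + 1), ∑ a ∈ antidiagonalTuple k (m - l),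
          memSum l 0 (fun u => F (u + pathCount a) - x) / (l.factorial : 𝕜)‖ := by
      rw [← h1, norm_div, norm_mul, RCLike.norm_natCast, RCLike.norm_natCast, hc]; ring
    rw [h2]
    refine (norm_sum_le _ _).trans ?_
    have h3 : ∀ l ∈ Finset.range (m + 1), ‖∑ a ∈ antidiagonalTuple k (m - l),
          memSum l 0 (fun u => F (u + pathCount a) - x) / (l.factorial : 𝕜)‖
        ≤ numComp k m * B * ((1 + (l : ℝ)) ^ 2 * (2 * α / (2 * α + 1)) ^ l) := by
      intro l hl
      have hl' : l ≤ m := Nat.lt_succ_iff.1 (Finset.mem_range.1 hl)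
      have hn' : (numComp k (m - l) : 𝕜) ≠ 0 := by rw [hk']; exact numComp_ne_zero k' _
      have h4 : ∑ a ∈ antidiagonalTuple k (m - l),
          memSum l 0 (fun u => F (u + pathCount a) - x) / (l.factorial : 𝕜)
          = (∑ G : SimpleGraph (Fin l), if IsMem 0 G then
            (numComp k (m - l) : 𝕜) *
              (compMean k (m - l) (fun a => F (compCount G + pathCount a)) - x) else 0)
            / (l.factorial : 𝕜) := by
        rw [← Finset.sum_div]
        congr 1
        simp only [memSum]
        rw [Finset.sum_comm]
        refine Finset.sum_congr rfl fun G _ => ?_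
        split_ifs
        · rw [mul_sub, compMean, mul_div_cancel₀ _ hn', Finset.sum_sub_distrib, Finset.sum_const,
            nsmul_eq_mul, numComp]
        · simp
      have h5 : ‖∑ G : SimpleGraph (Fin l), if IsMem 0 G then
            (numComp k (m - l) : 𝕜) *
              (compMean k (m - l) (fun a => F (compCount G + pathCount a)) - x) else 0‖
          ≤ memSum l 0 (fun _ => (1 : ℝ)) * (numComp k (m - l) * (B * (1 + l) ^ 2)) := by
        rw [memSum, Finset.sum_mul]
        refine (norm_sum_le _ _).trans (Finset.sum_le_sum fun G _ => ?_)
        split_ifs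
        · rw [norm_mul, RCLike.norm_natCast, one_mul]
          exact mul_le_mul_of_nonneg_left (h l hl' G) (by positivity)
        · simp
      rw [h4, norm_div, RCLike.norm_natCast]
      have h6 := memSum_zero_le_factorial l
      have h7 := numComp_sub_le hα hk hm hl'
      calc _ ≤ memSum l 0 (fun _ => (1 : ℝ)) * (numComp k (m - l) * (B * (1 + l) ^ 2))
            / (l.factorial : ℝ) := by gcongr
        _ = memSum l 0 (fun _ => (1 : ℝ)) / (l.factorial : ℝ)
            * (numComp k (m - l) * (B * (1 + l) ^ 2)) := by ring
        _ ≤ 1 * ((2 * α / (2 * α + 1)) ^ l * numComp k m * (B * (1 + l) ^ 2)) := by gcongr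
        _ = _ := by ring
    refine (Finset.sum_le_sum h3).trans ?_
    rw [← Finset.mul_sum, ← mul_assoc]
    refine mul_le_mul_of_nonneg_left ?_ (by positivity)
    exact (summable_sq_mul_pow hα).sum_le_tsum _ fun l _ => by positivity
  have hpos : 0 < memSum (2 * k + m) (2 * k) (fun _ => (1 : ℝ)) := by
    by_contra hneg
    have : c * memSum (2 * k + m) (2 * k) (fun _ => (1 : ℝ)) ≤ 0 :=
      mul_nonpos_of_nonneg_of_nonpos hc0.le (not_lt.1 hneg)
    linarith
  have hne : memSum (2 * k + m) (2 * k) (fun _ => (1 : 𝕜)) ≠ 0 := by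
    rw [← ofReal_memSum_one]
    exact_mod_cast hpos.ne'
  have hK := mul_nonneg hB (cycleMoment_nonneg hα)
  rw [integral_uniformGraph, div_sub' hne, mul_comm _ x, ← memSum_sub_const, norm_div,
    ← ofReal_memSum_one, RCLike.norm_ofReal, abs_of_pos hpos, div_le_iff₀ hpos]
  refine le_of_mul_le_mul_left ?_ hc0
  calc _ ≤ _ := hS
    _ ≤ (c * memSum (2 * k + m) (2 * k) (fun _ => (1 : ℝ))) * (B * cycleMoment α) := by gcongr
    _ = _ := by ring

/-! ### Mean and variance of the component counts -/

lemma density_eq (α : ℝ) (r : ℕ) :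
    density α (r + 2) = 1 / (1 + α) * (α / (1 + α)) ^ r := by
  rw [density, Nat.add_sub_cancel, show r + 2 - 1 = r + 1 by omega, div_pow, div_mul_div_comm,
    one_mul, pow_succ']

lemma abs_floor_sub_le {α : ℝ} (hα : 0 < α) (k : ℕ) :
    |((⌊α * (k : ℝ)⌋₊ : ℕ) : ℝ) - α * k| ≤ 1 := by
  have h1 := Nat.floor_le (by positivity : 0 ≤ α * (k : ℝ))
  have h2 := Nat.lt_floor_add_one (α * (k : ℝ))
  rw [abs_le]
  constructor <;> linarith

/-- The centre of the count of components of size `r + 2` varies slowly with the number of vertices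
on paths. -/
lemma abs_mul_partProb_sub_le {k : ℕ} (hk : 3 ≤ k) (r : ℕ) {l m : ℕ} (hl : l ≤ m) :
    |k * partProb r (k - 1) (m - l) - k * partProb r (k - 1) m| ≤ 2 * (r + 1) * l := by
  have hk0 : (3 : ℝ) ≤ k := by exact_mod_cast hk
  have h := abs_partProb_sub_le r (c := (k : ℝ) - 1) (by linarith) (m - l) m
  rw [Nat.cast_sub hl, show (m : ℝ) - l - m = -l by ring, abs_neg, Nat.abs_cast] at h
  rw [← mul_sub, abs_mul, Nat.abs_cast]
  calc (k : ℝ) * _ ≤ k * ((r + 1) * (l / (k - 1))) := by gcongr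
    _ = k / (k - 1) * ((r + 1) * l) := by ring
    _ ≤ 2 * ((r + 1) * l) := by
        gcongr
        rw [div_le_iff₀ (by linarith)]
        linarith
    _ = _ := by ring

lemma compMean_pathCount_eq {k : ℕ} (hk : 3 ≤ k) (M r : ℕ) :
    compMean (𝕜 := ℝ) k M (fun a => (pathCount a (r + 2) : ℝ)) = k * partProb r (k - 1) M := by
  obtain ⟨n, rfl⟩ : ∃ n, k = n + 2 := ⟨k - 2, by omega⟩
  rw [compMean_pathCount]
  push_cast
  rw [show (n : ℝ) + 2 - 1 = n + 1 by ring]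

lemma compMean_sq_sub_le {k : ℕ} (hk : 3 ≤ k) (M r : ℕ) :
    compMean (𝕜 := ℝ) k M (fun a => ((pathCount a (r + 2) : ℝ) - k * partProb r (k - 1) M) ^ 2)
      ≤ (1 + 2 * (r + 1) ^ 2) * k := by
  obtain ⟨n, rfl⟩ : ∃ n, k = n + 3 := ⟨k - 3, by omega⟩
  have h := compMean_sq_le n M r
  push_cast at h ⊢
  rwa [show (n : ℝ) + 3 - 1 = n + 2 by ring]

section
variable {α : ℝ} (hα : 0 < α) (r : ℕ)
include hα

/-- The mean of a component count is its centre up to a bounded error. -/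
lemma abs_integral_compCount_sub_le {k : ℕ} (hk : 3 ≤ k) :
    |∫ G, (compCount G (r + 2) : ℝ) ∂(uniformGraph (2 * k) ⌊α * (k : ℝ)⌋₊)
      - k * partProb r (k - 1) ⌊α * (k : ℝ)⌋₊| ≤ (1 + 2 * (r + 1)) * cycleMoment α := by
  refine norm_integral_uniformGraph_sub_le (𝕜 := ℝ) hα (by omega)
    (Nat.floor_le (by positivity)) (fun u => (u (r + 2) : ℝ)) _ (by positivity) fun l hl G => ?_
  set m := ⌊α * (k : ℝ)⌋₊
  have h1 : compMean (𝕜 := ℝ) k (m - l) (fun a => ((compCount G + pathCount a) (r + 2) : ℕ))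
      = compCount G (r + 2) + k * partProb r (k - 1) (m - l) := by
    simp only [Pi.add_apply, Nat.cast_add]
    rw [compMean_add, compMean_const (by omega), compMean_pathCount_eq hk]
  have h2 := abs_mul_partProb_sub_le hk r hl
  have h3 : (compCount G (r + 2) : ℝ) ≤ l := by exact_mod_cast compCount_le G (r + 2)
  rw [h1, Real.norm_eq_abs, add_sub_assoc]
  have h4 : (0 : ℝ) ≤ r := by positivity
  have h5 : (0 : ℝ) ≤ l := by positivity
  calc _ ≤ |(compCount G (r + 2) : ℝ)| + _ := abs_add_le _ _
    _ ≤ l + 2 * (r + 1) * l := add_le_add (by rwa [Nat.abs_cast]) h2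
    _ = (1 + 2 * (r + 1)) * l := by ring
    _ ≤ _ := by
        refine mul_le_mul_of_nonneg_left ?_ (by positivity)
        nlinarith

lemma integral_sq_compCount_sub_le {k : ℕ} (hk : 3 ≤ k) :
    ∫ G, ((compCount G (r + 2) : ℝ) - k * partProb r (k - 1) ⌊α * (k : ℝ)⌋₊) ^ 2
      ∂(uniformGraph (2 * k) ⌊α * (k : ℝ)⌋₊)
      ≤ (2 * (1 + 2 * (r + 1) ^ 2) + 2 * (1 + 2 * (r + 1)) ^ 2) * k * cycleMoment α := by
  set m := ⌊α * (k : ℝ)⌋₊ with hm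
  have hk0 : (1 : ℝ) ≤ k := by exact_mod_cast (by omega : 1 ≤ k)
  refine (le_abs_self _).trans ?_
  have := norm_integral_uniformGraph_sub_le (𝕜 := ℝ) (m := m) hα (by omega)
    (Nat.floor_le (by positivity)) (fun u => ((u (r + 2) : ℝ) - k * partProb r (k - 1) m) ^ 2) 0
    (B := (2 * (1 + 2 * (r + 1) ^ 2) + 2 * (1 + 2 * (r + 1)) ^ 2) * k) (by positivity)
    fun l hl G => ?_
  · simpa using this
  have h2 := abs_mul_partProb_sub_le hk r hl
  have h3 : (compCount G (r + 2) : ℝ) ≤ l := by exact_mod_cast compCount_le G (r + 2)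
  -- the shift caused by the components of `G` and by the change of total from `m` to `m - l`
  set c := (compCount G (r + 2) : ℝ) + (k * partProb r (k - 1) (m - l) - k * partProb r (k - 1) m)
    with hc
  have hl0 : (0 : ℝ) ≤ l := by positivity
  have hr0 : (0 : ℝ) ≤ r := by positivity
  have hc1 : |c| ≤ (1 + 2 * (r + 1)) * l := by
    calc _ ≤ |(compCount G (r + 2) : ℝ)| + _ := abs_add_le _ _
      _ ≤ l + 2 * (r + 1) * l := add_le_add (by rwa [Nat.abs_cast]) h2
      _ = _ := by ring
  have hc2 : c ^ 2 ≤ ((1 + 2 * (r + 1)) * l) ^ 2 := by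
    rw [← sq_abs]; gcongr
  have h5 : compMean (𝕜 := ℝ) k (m - l)
      (fun a => ((((compCount G + pathCount a) (r + 2) : ℕ) : ℝ) - k * partProb r (k - 1) m) ^ 2)
      ≤ compMean (𝕜 := ℝ) k (m - l) (fun a => 2 * ((pathCount a (r + 2) : ℝ)
        - k * partProb r (k - 1) (m - l)) ^ 2 + 2 * c ^ 2) := by
    refine compMean_mono fun a _ => ?_
    set x := (pathCount a (r + 2) : ℝ) - k * partProb r (k - 1) (m - l) with hx
    have : (((compCount G + pathCount a) (r + 2) : ℕ) : ℝ) - k * partProb r (k - 1) m = x + c := by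
      simp only [Pi.add_apply, Nat.cast_add, hx, hc]; ring
    rw [this]
    nlinarith [sq_nonneg (x - c)]
  rw [compMean_add, compMean_const_mul, compMean_const (by omega)] at h5
  have h6 := compMean_sq_sub_le hk (m - l) r
  have h7 : 0 ≤ compMean (𝕜 := ℝ) k (m - l)
      (fun a => ((((compCount G + pathCount a) (r + 2) : ℕ) : ℝ) - k * partProb r (k - 1) m) ^ 2) :=
    div_nonneg (Finset.sum_nonneg fun _ _ => sq_nonneg _) (Nat.cast_nonneg _)
  rw [sub_zero, Real.norm_of_nonneg h7]
  have h8 : (1 : ℝ) ≤ (1 + l) ^ 2 := by nlinarith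
  calc _ ≤ 2 * ((1 + 2 * ((r : ℝ) + 1) ^ 2) * k) + 2 * ((1 + 2 * (r + 1)) * l) ^ 2 := by linarith
    _ = 2 * (1 + 2 * (r + 1) ^ 2) * k * 1 + 2 * (1 + 2 * (r + 1)) ^ 2 * 1 * (l : ℝ) ^ 2 := by ring
    _ ≤ 2 * (1 + 2 * (r + 1) ^ 2) * k * (1 + l) ^ 2
        + 2 * (1 + 2 * (r + 1)) ^ 2 * k * (1 + l : ℝ) ^ 2 := by gcongr; linarith
    _ = _ := by ring

/-- The centre `k * partProb r (k - 1) m` of the count is the announced centre up to a bounded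
error. -/
lemma abs_mul_partProb_sub_density_le {k : ℕ} (hk : 3 ≤ k) :
    |k * partProb r (k - 1) ⌊α * (k : ℝ)⌋₊ - density α (r + 2) * k|
      ≤ 2 * (r + 1) * (1 + α + r) := by
  set m := ⌊α * (k : ℝ)⌋₊ with hm
  have hk0 : (3 : ℝ) ≤ k := by exact_mod_cast hk
  have h1 := abs_partProb_sub_geometric_le r hα (c := (k : ℝ) - 1) (by linarith) m
  rw [← density_eq] at h1
  have h2 : |(m : ℝ) - α * (k - 1)| ≤ 1 + α := by
    have h3 := abs_le.1 (abs_floor_sub_le hα k)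
    rw [← hm] at h3
    rw [abs_le]
    constructor <;> nlinarith
  rw [mul_comm (density α (r + 2)), ← mul_sub, abs_mul, Nat.abs_cast]
  calc (k : ℝ) * _ ≤ k * ((r + 1) * ((1 + α + r) / (k - 1))) := by
        refine mul_le_mul_of_nonneg_left (h1.trans ?_) (by positivity)
        refine mul_le_mul_of_nonneg_left ?_ (by positivity)
        exact div_le_div_of_nonneg_right (by linarith) (by linarith)
    _ = k / (k - 1) * ((r + 1) * (1 + α + r)) := by ring
    _ ≤ 2 * ((r + 1) * (1 + α + r)) := by
        gcongr
        rw [div_le_iff₀ (by linarith)]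
        linarith
    _ = _ := by ring

lemma isEquivalent_integral_numComponents :
    (fun k : ℕ => ∫ G, (numComponents (r + 2) G : ℝ) ∂(uniformGraph (2 * k) ⌊α * (k : ℝ)⌋₊))
      ~[atTop] fun k : ℕ => density α (r + 2) * (k : ℝ) := by
  have hd : 0 < density α (r + 2) := by rw [density]; positivity
  refine IsBigO.trans_isLittleO (g := fun _ : ℕ => (1 : ℝ)) ?_ ?_
  · refine IsBigO.of_bound ((1 + 2 * (r + 1)) * cycleMoment α + 2 * (r + 1) * (1 + α + r)) ?_
    filter_upwards [eventually_ge_atTop 3] with k hk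
    have h1 := abs_integral_compCount_sub_le hα r hk
    have h2 := abs_mul_partProb_sub_density_le hα r hk
    simp only [Pi.sub_apply, norm_one, mul_one, Real.norm_eq_abs]
    simp only [numComponents_eq_compCount _ (Nat.succ_ne_zero (r + 1))]
    exact (abs_sub_le _ _ _).trans (add_le_add h1 h2)
  · rw [isLittleO_one_left_iff]
    simp only [norm_mul, Real.norm_of_nonneg hd.le, RCLike.norm_natCast]
    exact Tendsto.const_mul_atTop hd tendsto_natCast_atTop_atTop

lemma isBigO_variance_numComponents :
    (fun k : ℕ => variance (fun G => (numComponents (r + 2) G : ℝ))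
      (uniformGraph (2 * k) ⌊α * (k : ℝ)⌋₊)) =O[atTop] fun k : ℕ => (k : ℝ) := by
  refine IsBigO.of_bound
    ((2 * (1 + 2 * (r + 1) ^ 2) + 2 * (1 + 2 * (r + 1)) ^ 2) * cycleMoment α) ?_
  filter_upwards [eventually_ge_atTop 3] with k hk
  have h1 := integral_sq_compCount_sub_le hα r hk
  rw [Real.norm_of_nonneg (variance_nonneg _ _), RCLike.norm_natCast]
  simp only [numComponents_eq_compCount _ (Nat.succ_ne_zero (r + 1))]
  rw [← variance_sub_const (Integrable.of_finite).aestronglyMeasurable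
    (k * partProb r (k - 1) ⌊α * (k : ℝ)⌋₊)]
  refine (variance_le_expectation_sq (Integrable.of_finite).aestronglyMeasurable).trans ?_
  refine h1.trans_eq (by ring)

end

/-! ### Convergence to the Gaussian law -/

lemma norm_exp_mul_I_sub_exp_le (x y : ℝ) :
    ‖Complex.exp (x * Complex.I) - Complex.exp (y * Complex.I)‖ ≤ |x - y| := by
  have h : Complex.exp (x * Complex.I) - Complex.exp (y * Complex.I)
      = Complex.exp (y * Complex.I) * (Complex.exp (Complex.I * ((x - y : ℝ) : ℂ)) - 1) := by
    rw [mul_sub, ← Complex.exp_add, mul_one]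
    congr 2
    push_cast
    ring
  rw [h, norm_mul, Complex.norm_exp_ofReal_mul_I, one_mul]
  exact Real.norm_exp_I_mul_ofReal_sub_one_le

/-- Over the compositions of `M`, the sum of the residuals is the centred linear statistic of the
part counts, up to a constant that vanishes at `M = α * k`. -/
lemma sum_residual {α : ℝ} {R : ℕ} {ϑ : ℕ → ℝ} (hϑ : ∀ r, R ≤ r → ϑ r = 0) {k M : ℕ}
    {a : Fin k → ℕ} (ha : a ∈ antidiagonalTuple k M) :
    ∑ i, residual α R ϑ (a i)
      = ∑ r ∈ Finset.range R, ϑ r * ((pathCount a (r + 2) : ℝ) - density α (r + 2) * k)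
        - slope α R ϑ * (M - α * k) := by
  have h1 : (∑ i, (a i : ℝ)) = M := by
    rw [← Nat.cast_sum, Finset.Nat.mem_antidiagonalTuple.1 ha]
  simp only [residual, Finset.sum_sub_distrib, mul_sub, sum_comp_eq_sum_pathCount hϑ,
    ← Finset.mul_sum, h1, density_eq]
  simp only [Finset.sum_const, Finset.card_univ, Fintype.card_fin, nsmul_eq_mul, Finset.mul_sum]
  rw [Finset.sum_congr rfl fun r _ => show (k : ℝ) * (ϑ r * (1 / (1 + α) * (α / (1 + α)) ^ r))
    = ϑ r * (1 / (1 + α) * (α / (1 + α)) ^ r * k) by ring]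
  ring

/-- Convergence of the characteristic functions of linear statistics of the component counts. -/
lemma tendsto_integral_exp_compCount {α : ℝ} (hα : 0 < α) {R : ℕ} {ϑ : ℕ → ℝ}
    (hϑ : ∀ r, R ≤ r → ϑ r = 0) :
    Tendsto (fun k : ℕ => ∫ G, Complex.exp (((∑ r ∈ Finset.range R,
        ϑ r * ((compCount G (r + 2) : ℝ) - density α (r + 2) * k)) / √k : ℝ) * Complex.I)
        ∂(uniformGraph (2 * k) ⌊α * (k : ℝ)⌋₊)) atTop
      (𝓝 (Complex.exp (-(residualVar α R ϑ : ℂ) / 2))) := by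
  obtain ⟨C, hC0, hC⟩ := exists_norm_compCharFun_sub_le hα hϑ
  set b := slope α R ϑ with hb
  set T := ∑ r ∈ Finset.range R, |ϑ r| with hT
  have hT0 : 0 ≤ T := Finset.sum_nonneg fun _ _ => abs_nonneg _
  refine (tendsto_compCharFun hα hϑ).congr_dist ?_
  have hlim : Tendsto (fun k : ℕ => (T + |b| + 2 * C) * cycleMoment α * (√(k : ℝ))⁻¹) atTop
      (𝓝 0) := by
    rw [← mul_zero ((T + |b| + 2 * C) * cycleMoment α)]
    exact (tendsto_inv_atTop_zero.comp
      (Real.tendsto_sqrt_atTop.comp tendsto_natCast_atTop_atTop)).const_mul _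
  refine squeeze_zero' (Eventually.of_forall fun _ => dist_nonneg) ?_ hlim
  filter_upwards [eventually_ge_atTop 3] with k hk
  have hk1 : (1 : ℝ) ≤ k := by exact_mod_cast (by omega : 1 ≤ k)
  have hs : 0 < √(k : ℝ) := Real.sqrt_pos.2 (by linarith)
  have hfl := abs_floor_sub_le hα k
  set m := ⌊α * (k : ℝ)⌋₊ with hm
  rw [dist_comm, dist_eq_norm]
  have key := norm_integral_uniformGraph_sub_le (𝕜 := ℂ) (m := m) hα (by omega : 2 ≤ k)
    (Nat.floor_le (by positivity)) (fun u => Complex.exp (((∑ r ∈ Finset.range R,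
      ϑ r * ((u (r + 2) : ℝ) - density α (r + 2) * k)) / √k : ℝ) * Complex.I))
    (compCharFun (residual α R ϑ) k m) (B := (T + |b| + 2 * C) / √k) (by positivity)
    fun l hl G => ?_
  · exact key.trans_eq (by ring)
  have hl0 : (0 : ℝ) ≤ l := by positivity
  have hMl : |((m - l : ℕ) : ℝ) - α * k| ≤ 1 + l := by
    rw [Nat.cast_sub hl]
    have := abs_le.1 hfl
    rw [abs_le]
    constructor <;> linarith
  -- on compositions of `m - l`, replacing the statistic by the sum of residuals costs the counts of
  -- `G` and a multiple of `m - l - α * k`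
  have hpoint : ∀ a ∈ antidiagonalTuple k (m - l),
      ‖Complex.exp (((∑ r ∈ Finset.range R,
        ϑ r * ((((compCount G + pathCount a) (r + 2) : ℕ) : ℝ) - density α (r + 2) * k)) / √k : ℝ)
          * Complex.I)
        - Complex.exp (((∑ i, residual α R ϑ (a i)) / √k : ℝ) * Complex.I)‖
      ≤ (T * l + |b| * (1 + l)) / √k := by
    intro a ha
    refine (norm_exp_mul_I_sub_exp_le _ _).trans ?_
    rw [← sub_div, abs_div, abs_of_pos hs]
    refine div_le_div_of_nonneg_right ?_ hs.le
    rw [sum_residual hϑ ha, ← hb]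
    have h1 : ∑ r ∈ Finset.range R, ϑ r * ((((compCount G + pathCount a) (r + 2) : ℕ) : ℝ)
          - density α (r + 2) * k)
        = ∑ r ∈ Finset.range R, ϑ r * compCount G (r + 2)
          + ∑ r ∈ Finset.range R, ϑ r * ((pathCount a (r + 2) : ℝ) - density α (r + 2) * k) := by
      rw [← Finset.sum_add_distrib]
      refine Finset.sum_congr rfl fun r _ => ?_
      simp only [Pi.add_apply, Nat.cast_add]
      ring
    rw [h1, show ∀ x y z : ℝ, x + y - (y - z) = x + z by intros; ring]
    refine (abs_add_le _ _).trans (add_le_add ?_ ?_)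
    · rw [hT, Finset.sum_mul]
      refine (Finset.abs_sum_le_sum_abs _ _).trans (Finset.sum_le_sum fun r _ => ?_)
      rw [abs_mul, Nat.abs_cast]
      have : (compCount G (r + 2) : ℝ) ≤ l := by exact_mod_cast compCount_le G (r + 2)
      gcongr
    · rw [abs_mul]
      gcongr
  have h1 := hC k (m - l) m hk hfl
  have h2 : ‖compMean k (m - l) (fun a => Complex.exp (((∑ r ∈ Finset.range R,
        ϑ r * ((((compCount G + pathCount a) (r + 2) : ℕ) : ℝ) - density α (r + 2) * k)) / √k : ℝ)
          * Complex.I)) - compCharFun (residual α R ϑ) k (m - l)‖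
      ≤ (T * l + |b| * (1 + l)) / √k := by
    rw [compCharFun, ← compMean_sub]
    refine (norm_compMean_le _).trans ((compMean_mono hpoint).trans_eq ?_)
    rw [compMean_const (by omega)]
  have h3 : (((m - l : ℕ) : ℝ) - α * k) ^ 2 / k ≤ (1 + l) ^ 2 := by
    rw [div_le_iff₀ (by linarith), ← sq_abs]
    calc _ ≤ (1 + (l : ℝ)) ^ 2 * 1 := by rw [mul_one]; gcongr
      _ ≤ _ := by gcongr
  have h4 : (1 : ℝ) ≤ (1 + l) ^ 2 := by nlinarith
  have h5 : (1 : ℝ) + l ≤ (1 + l) ^ 2 := by nlinarith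
  refine (norm_sub_le_norm_sub_add_norm_sub _ (compCharFun (residual α R ϑ) k (m - l)) _).trans ?_
  calc _ ≤ (T * l + |b| * (1 + l)) / √k + C / √k * (1 + (((m - l : ℕ) : ℝ) - α * k) ^ 2 / k) :=
        add_le_add h2 h1
    _ ≤ (T * (1 + l) ^ 2 + |b| * (1 + l) ^ 2) / √k + C / √k * ((1 + l) ^ 2 + (1 + l) ^ 2) := by
        gcongr
        linarith
    _ = _ := by ring

section
variable {α : ℝ} {q : ℕ}

/-- A vector indexed by the sizes `2, …, q`, as a function of the number `r` of inner vertices of a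
path, extended by zero. -/
noncomputable def extendZero (q : ℕ) (t : Finset.Icc 2 q → ℝ) (r : ℕ) : ℝ :=
  if h : r + 2 ∈ Finset.Icc 2 q then t ⟨r + 2, h⟩ else 0

lemma extendZero_of_le (t : Finset.Icc 2 q → ℝ) {r : ℕ} (h : q - 1 ≤ r) :
    extendZero q t r = 0 := by
  rw [extendZero, dif_neg]
  rw [Finset.mem_Icc]
  omega

lemma sum_extendZero (t : Finset.Icc 2 q → ℝ) (f : ℕ → ℝ → ℝ) :
    ∑ r ∈ Finset.range (q - 1), f (r + 2) (extendZero q t r)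
      = ∑ j : Finset.Icc 2 q, f j (t j) := by
  symm
  refine Finset.sum_bij' (fun j _ => (j : ℕ) - 2)
    (fun r hr => ⟨r + 2, by rw [Finset.mem_range] at hr; rw [Finset.mem_Icc]; omega⟩)
    ?_ ?_ ?_ ?_ ?_
  · rintro ⟨j, hj⟩ -
    rw [Finset.mem_Icc] at hj
    rw [Finset.mem_range]
    dsimp only
    omega
  · intro r hr
    simp
  · rintro ⟨j, hj⟩ -
    rw [Finset.mem_Icc] at hj
    simp only [Subtype.mk.injEq]
    omega
  · intro r hr
    simp
  · rintro ⟨j, hj⟩ -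
    have hj' := Finset.mem_Icc.1 hj
    have h2 : j - 2 + 2 = j := by omega
    have h3 : extendZero q t (j - 2) = t ⟨j, hj⟩ := by
      rw [extendZero, dif_pos (by rw [h2]; exact hj)]
      congr 2
    simp only [h2, h3]

/-- The limit covariance as a multinomial covariance minus a correction of rank one, which is due
to conditioning on the sum of the parts. -/
lemma limitCov_apply (hα : 0 < α) (i j : Finset.Icc 2 q) :
    limitCov α q i j = (if i = j then density α i else 0) - density α i * density α j
      - density α i * ((i : ℕ) - 2 - α) * (density α j * ((j : ℕ) - 2 - α)) / (α * (1 + α)) := by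
  obtain ⟨i, hi⟩ := i
  obtain ⟨j, hj⟩ := j
  obtain ⟨r, rfl⟩ : ∃ r, i = r + 2 := ⟨i - 2, by have := (Finset.mem_Icc.1 hi).1; omega⟩
  obtain ⟨s, rfl⟩ : ∃ s, j = s + 2 := ⟨j - 2, by have := (Finset.mem_Icc.1 hj).1; omega⟩
  simp only [limitCov, Matrix.of_apply, Subtype.mk.injEq, density_eq]
  rw [show r + 2 + (s + 2) - 4 = r + s by omega,
    show r + 2 + (s + 2) - 2 = r + 1 + (s + 1) by omega,
    Nat.add_sub_cancel]
  have h1 : α ^ (r + s) / (1 + α) ^ (r + 1 + (s + 1))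
      = 1 / (1 + α) * (α / (1 + α)) ^ r * (1 / (1 + α) * (α / (1 + α)) ^ s) := by
    rw [div_pow, div_pow, pow_add, pow_add, pow_succ, pow_succ]
    field_simp
  rw [h1]
  split_ifs <;> ring

lemma dotProduct_limitCov (hα : 0 < α) (t : Finset.Icc 2 q → ℝ) :
    t ⬝ᵥ (limitCov α q).mulVec t = residualVar α (q - 1) (extendZero q t) := by
  have h1 := sum_extendZero t fun j x => x ^ 2 * density α j
  have h2 := sum_extendZero t fun j x => x * density α j
  have h3 := sum_extendZero t fun j x => x * density α j * ((j : ℝ) - 2 - α)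
  simp only [residualVar, negBinWeight_one, ← density_eq]
  simp only [Nat.cast_add, Nat.cast_ofNat, add_sub_cancel_right] at h3
  rw [h1, h2, h3]
  simp only [dotProduct, Matrix.mulVec, limitCov_apply hα]
  rw [sq, sq, Finset.sum_mul_sum, Finset.sum_mul_sum, Finset.sum_div, ← Finset.sum_sub_distrib,
    ← Finset.sum_sub_distrib]
  refine Finset.sum_congr rfl fun i _ => ?_
  have h4 : t i ^ 2 * density α i = t i * ∑ j, (if i = j then density α i else 0) * t j := by
    simp
    ring
  rw [h4, Finset.mul_sum, Finset.mul_sum, Finset.sum_div, ← Finset.sum_sub_distrib,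
    ← Finset.sum_sub_distrib]
  refine Finset.sum_congr rfl fun j _ => ?_
  ring

/-- The quadratic form of the limit covariance is a variance. -/
lemma posSemidef_limitCov (hα : 0 < α) (q : ℕ) : (limitCov α q).PosSemidef := by
  refine Matrix.PosSemidef.of_dotProduct_mulVec_nonneg ?_ fun t => ?_
  · ext i j
    rw [Matrix.conjTranspose_apply, star_trivial, limitCov_apply hα, limitCov_apply hα]
    by_cases h : i = j
    · simp [h]
    · simp only [h, Ne.symm h, if_false]
      ring
  · rw [star_trivial, dotProduct_limitCov hα]
    exact residualVar_nonneg hα fun r hr => extendZero_of_le t hr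

/-- The central limit theorem, by Lévy's continuity theorem. -/
lemma tendstoInDistribution_rescaledCounts (hα : 0 < α) (q : ℕ) :
    TendstoInDistribution
      (fun (k : ℕ) (G : SimpleGraph (Fin (2 * k + ⌊α * (k : ℝ)⌋₊))) => rescaledCounts α q k G)
      atTop (fun x : EuclideanSpace ℝ (Finset.Icc 2 q) => x)
      (fun k : ℕ => uniformGraph (2 * k) ⌊α * (k : ℝ)⌋₊)
      (multivariateGaussian 0 (limitCov α q)) where
  forall_aemeasurable k := (Integrable.of_finite).aemeasurable
  aemeasurable_limit := aemeasurable_id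
  tendsto := by
    refine ProbabilityMeasure.tendsto_iff_tendsto_charFun.2 fun t => ?_
    have hlim := tendsto_integral_exp_compCount hα (R := q - 1) (ϑ := extendZero q (t : _ → ℝ))
      fun r hr => extendZero_of_le _ hr
    have he : charFun ((multivariateGaussian 0 (limitCov α q)).map fun x => x) t
        = Complex.exp (-(residualVar α (q - 1) (extendZero q (t : _ → ℝ)) : ℂ) / 2) := by
      rw [Measure.map_id', charFun_multivariateGaussian (posSemidef_limitCov hα q),
        ← dotProduct_limitCov hα]
      simp
      ring_nf
    simp only [ProbabilityMeasure.coe_mk]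
    rw [he]
    refine hlim.congr fun k => ?_
    rw [charFun_apply, integral_map (Integrable.of_finite).aemeasurable
      (by fun_prop)]
    refine integral_congr_ae (Eventually.of_forall fun G => ?_)
    dsimp only
    congr 3
    rw [sum_extendZero (t : _ → ℝ) fun j x => x * ((compCount G j : ℝ) - density α j * k)]
    simp only [rescaledCounts, PiLp.inner_apply, RCLike.inner_apply, conj_trivial]
    rw [Finset.sum_div]
    refine Finset.sum_congr rfl fun j _ => ?_
    have hj := (Finset.mem_Icc.1 j.2).1
    rw [numComponents_eq_compCount G (by omega)]
    ring

end

end DegOneTwo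

theorem theorem1 (α : ℝ) (hα : 0 < α) :
    (∀ j : ℕ, 2 ≤ j →
      ((fun k : ℕ => ∫ G, (DegOneTwo.numComponents j G : ℝ)
            ∂(DegOneTwo.uniformGraph (2 * k) ⌊α * (k : ℝ)⌋₊))
          ~[atTop] fun k : ℕ => DegOneTwo.density α j * (k : ℝ)) ∧
      ((fun k : ℕ => variance (fun G => (DegOneTwo.numComponents j G : ℝ))
            (DegOneTwo.uniformGraph (2 * k) ⌊α * (k : ℝ)⌋₊))
          =O[atTop] fun k : ℕ => (k : ℝ))) ∧
    (∀ q : ℕ, 2 ≤ q →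
      (DegOneTwo.limitCov α q).PosSemidef ∧
      TendstoInDistribution
        (fun (k : ℕ) (G : SimpleGraph (Fin (2 * k + ⌊α * (k : ℝ)⌋₊))) =>
          DegOneTwo.rescaledCounts α q k G)
        atTop
        (fun x : EuclideanSpace ℝ (Finset.Icc 2 q) => x)
        (fun k : ℕ => DegOneTwo.uniformGraph (2 * k) ⌊α * (k : ℝ)⌋₊)
        (multivariateGaussian 0 (DegOneTwo.limitCov α q))) := by
  refine ⟨fun j hj => ?_, fun q _ => ⟨DegOneTwo.posSemidef_limitCov hα q,
    DegOneTwo.tendstoInDistribution_rescaledCounts hα q⟩⟩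
  obtain ⟨r, rfl⟩ : ∃ r, j = r + 2 := ⟨j - 2, by omega⟩
  exact ⟨DegOneTwo.isEquivalent_integral_numComponents hα r,
    DegOneTwo.isBigO_variance_numComponents hα r⟩
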